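/- A convex polytope is a nonempty bounded intersection of finitely many closed half-spaces in some $\mathbb R^m$, $m\ge 0$; two polytopes are combinatorially equivalent if their posets of nonempty faces (the polytope itself included) are isomorphic. Let $\mathfrak P$ be the free abelian group on the combinatorial equivalence classes of convex polytopes, a commutative ring under the product of polytopes whose unit is the point. For a polytope $P$ put $$F_P(t)=\sum_{f} f\,t^{\operatorname{codim} f}\in\mathfrak P[t],\qquad P^\circ=F_P(-1)\in\mathfrak P,$$ where $f$ runs over all nonempty faces of $P$ (including $P$), $\operatorname{codim} f=\dim P-\dim f$; $P^\circ$ is called the motivic interior of $P$. For a connected simple graph $\Gamma$ with $n\ge 1$ vertices $1,\dots,n$, the graph-associahedron is the polytope $$P_\Gamma=\Big\{x\in\mathbb R^n:\ \sum_{i=1}^n x_i=3^n,\ \ \sum_{i\in S}x_i\ge 3^{|S|}\ \text{ for all } S\subsetneq\{1,\dots,n\} \text{ inducing a (nonempty) connected subgraph of } \Gamma\Big\}.$$ Let $\pi_n$ (permutohedron) and $S_n$ (stellohedron) be the graph-associahedra of the complete graph and of the star graph on $n\ge1$ vertices (one centre and $n-1$ leaves), and put $\pi_n^\circ=F_{\pi_n}(-\pi_1)$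 (this equals the motivic interior of $\pi_n$, since $\pi_1$ is a point). Define the following formal power series over $\mathfrak P\otimes\mathbb Q$: $$\Pi(x)=1+\sum_{n=1}^\infty \pi_n\frac{x^n}{n!},\qquad \Pi^\circ(x)=1-\sum_{n=1}^\infty \pi_n^\circ\frac{x^n}{n!},$$ $$S(x)=\sum_{n=0}^\infty S_{n+1}\frac{x^n}{n!},\qquad S^\circ(x)=\sum_{n=0}^\infty S_{n+1}^\circ\frac{x^n}{n!},$$ where $S_{n+1}^\circ$ is the motivic interior of $S_{n+1}$. **Theorem 7.1.** In $(\mathfrak P\otimes\mathbb Q)[[x]]$ the series $\Pi(x)$ is invertible and $$S^\circ(x)=e^{-x}\,\Pi^\circ(x)\,S(x)=e^{-x}\,\Pi(x)^{-1}\,S(x).$$ -/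

import Mathlib

namespace PolytopeRing

section Polytopes

variable {E F : Type*} [NormedAddCommGroup E] [NormedSpace ℝ E]
  [NormedAddCommGroup F] [NormedSpace ℝ F]

/-- A (nonempty) convex polytope: a nonempty bounded intersection of finitely many closed
half-spaces. -/
def IsPolytope (P : Set E) : Prop :=
  P.Nonempty ∧ Bornology.IsBounded P ∧
    ∃ H : Finset ((E →L[ℝ] ℝ) × ℝ), P = {x | ∀ h ∈ H, h.1 x ≤ h.2}

/-- The poset of nonempty faces of `P` (with `P` itself included), ordered by inclusion.
A face is the set of maximizers on `P` of some linear functional. -/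
abbrev Face (P : Set E) : Type _ := {A : Set E // A.Nonempty ∧ IsExposed ℝ P A}

/-- The dimension of a polytope: the dimension of its affine span. -/
noncomputable def dim (P : Set E) : ℕ := Module.finrank ℝ (vectorSpan ℝ P)

theorem IsPolytope.face {P : Set E} (hP : IsPolytope P) (A : Face P) : IsPolytope A.1 := by
  classical
  obtain ⟨-, hb, H, hH⟩ := hP
  obtain ⟨A, hA, hexp⟩ := A
  refine ⟨hA, hb.subset hexp.subset, ?_⟩
  obtain ⟨l, hl⟩ := hexp hA
  obtain ⟨a, ha⟩ := id hA
  refine ⟨insert (-l, -(l a)) H, ?_⟩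
  have ha' := ha
  rw [hl] at ha'
  ext x
  simp only [Finset.mem_insert, forall_eq_or_imp, Set.mem_ofPred_eq]
  rw [hl]
  constructor
  · rintro ⟨hx, hmax⟩
    refine ⟨by simpa using hmax a ha'.1, ?_⟩
    rw [hH] at hx
    exact hx
  · rintro ⟨h1, h2⟩
    have hxP : x ∈ P := by rw [hH]; exact h2
    refine ⟨hxP, fun y hy => (ha'.2 y hy).trans (by simpa using h1)⟩

/-- A polytope has finitely many faces. -/
theorem IsPolytope.finite_face {P : Set E} (hP : IsPolytope P) : Finite (Face P) := by
  classical
  obtain ⟨-, -, H, hH⟩ := hP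
  have key : ∀ A : Face P, ∃ I : Finset ((E →L[ℝ] ℝ) × ℝ), I ⊆ H ∧
      A.1 = {x ∈ P | ∀ h ∈ I, h.1 x = h.2} := by
    rintro ⟨A, hA, hexp⟩
    obtain ⟨l, hl⟩ := hexp hA
    -- a point of `A` at which as few as possible of the inequalities are equalities
    obtain ⟨a, haA, hmin⟩ : ∃ a ∈ A, ∀ b ∈ A, ∀ h ∈ H, h.1 a = h.2 → h.1 b = h.2 := by
      have hind : ∀ K : Finset ((E →L[ℝ] ℝ) × ℝ), K ⊆ H →
          ∃ a ∈ A, ∀ b ∈ A, ∀ h ∈ K, h.1 a = h.2 → h.1 b = h.2 := by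
        intro K
        induction K using Finset.induction_on with
        | empty => intro _; exact ⟨hA.some, hA.some_mem, by simp⟩
        | insert k K hk ih =>
          intro hK
          obtain ⟨a, ha, hmin⟩ := ih fun x hx => hK (Finset.mem_insert_of_mem hx)
          by_cases hall : ∀ b ∈ A, k.1 b = k.2
          · refine ⟨a, ha, fun b hb h hh => ?_⟩
            rcases Finset.mem_insert.1 hh with rfl | hh
            · exact fun _ => hall b hb
            · exact hmin b hb h hh
          · push Not at hall
            obtain ⟨c, hc, hck⟩ := hall
            have haP : a ∈ P := hexp.subset ha
            have hcP : c ∈ P := hexp.subset hc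
            rw [hH] at haP hcP
            have hmid : ∀ f : E →L[ℝ] ℝ,
                f ((1 / 2 : ℝ) • a + (1 / 2 : ℝ) • c) = (f a + f c) / 2 := by
              intro f; simp; ring
            refine ⟨(1 / 2 : ℝ) • a + (1 / 2 : ℝ) • c, ?_, ?_⟩
            · rw [hl] at ha hc ⊢
              refine ⟨?_, fun y hy => ?_⟩
              · rw [hH]
                intro h hh
                rw [hmid]
                linarith [haP h hh, hcP h hh]
              · rw [hmid]
                linarith [ha.2 y hy, hc.2 y hy]
            · intro b hb h hh heq
              rw [hmid] at heq
              have h1 := haP h (hK hh)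
              have h2 := hcP h (hK hh)
              rcases Finset.mem_insert.1 hh with rfl | hh
              · exact absurd (by linarith) hck
              · exact hmin b hb h hh (by linarith)
      exact hind H subset_rfl
    refine ⟨H.filter fun h => h.1 a = h.2, Finset.filter_subset _ _, ?_⟩
    have haP : a ∈ P := hexp.subset haA
    have haH := haP
    rw [hH] at haH
    ext y
    constructor
    · intro hy
      refine ⟨hexp.subset hy, fun h hh => ?_⟩
      obtain ⟨h1, h2⟩ := Finset.mem_filter.1 hh
      exact hmin y hy h h1 h2
    · rintro ⟨hyP, hy⟩
      have hyH := hyP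
      rw [hH] at hyH
      -- move slightly from `a` away from `y`, staying inside `P`
      obtain ⟨ε, hε, hεH⟩ : ∃ ε : ℝ, 0 < ε ∧ ∀ h ∈ H, h.1 (a + ε • (a - y)) ≤ h.2 := by
        have hev : ∀ᶠ ε : ℝ in nhdsWithin 0 (Set.Ioi 0),
            ∀ h ∈ H, h.1 (a + ε • (a - y)) ≤ h.2 := by
          rw [Filter.eventually_all_finset]
          intro h hh
          by_cases heq : h.1 a = h.2
          · have := hy h (Finset.mem_filter.2 ⟨hh, heq⟩)
            exact Filter.Eventually.of_forall fun ε => by simp [heq, this]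
          · have hlt : h.1 (a + (0 : ℝ) • (a - y)) < h.2 := by
              simpa using lt_of_le_of_ne (haH h hh) heq
            have hc : Continuous fun ε : ℝ => h.1 (a + ε • (a - y)) := by fun_prop
            have := (hc.tendsto 0).eventually_lt_const hlt
            exact (this.filter_mono nhdsWithin_le_nhds).mono fun ε h => h.le
        obtain ⟨ε, h1, h2⟩ := (hev.and self_mem_nhdsWithin).exists
        exact ⟨ε, h2, h1⟩
      have hmem : a + ε • (a - y) ∈ P := by rw [hH]; exact hεH
      have ha2 := haA
      rw [hl] at ha2
      have hle := ha2.2 _ hmem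
      simp only [map_add, map_smul, map_sub, smul_eq_mul] at hle
      have hya : l a ≤ l y := by
        by_contra hlt
        push Not at hlt
        nlinarith [mul_pos hε (sub_pos.2 hlt)]
      change y ∈ A
      rw [hl]
      exact ⟨hyP, fun z hz => (ha2.2 z hz).trans hya⟩
  choose I hIH hI using key
  refine Finite.of_injective (fun A : Face P => (⟨I A, Finset.mem_powerset.2 (hIH A)⟩ : H.powerset))
    fun A B hAB => ?_
  have hAB' : I A = I B := congrArg Subtype.val hAB
  exact Subtype.ext (by rw [hI A, hI B, hAB'])

theorem IsPolytope.prod {P : Set E} {Q : Set F} (hP : IsPolytope P) (hQ : IsPolytope Q) :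
    IsPolytope (P ×ˢ Q) := by
  classical
  obtain ⟨hP0, hPb, H, hH⟩ := hP
  obtain ⟨hQ0, hQb, K, hK⟩ := hQ
  refine ⟨hP0.prod hQ0, hPb.prod hQb,
    H.image (fun h => (h.1.comp (ContinuousLinearMap.fst ℝ E F), h.2)) ∪
      K.image (fun h => (h.1.comp (ContinuousLinearMap.snd ℝ E F), h.2)), ?_⟩
  ext ⟨x, y⟩
  simp only [Set.mem_prod, hH, hK, Set.mem_ofPred_eq, Finset.mem_union, Finset.mem_image]
  constructor
  · rintro ⟨h1, h2⟩ _ (⟨k, hk, rfl⟩ | ⟨k, hk, rfl⟩)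
    · exact h1 k hk
    · exact h2 k hk
  · intro h
    exact ⟨fun k hk => h _ (Or.inl ⟨k, hk, rfl⟩), fun k hk => h _ (Or.inr ⟨k, hk, rfl⟩)⟩

theorem IsPolytope.image {P : Set E} (hP : IsPolytope P) (e : E ≃L[ℝ] F) :
    IsPolytope (e '' P) := by
  classical
  obtain ⟨hP0, hPb, H, hH⟩ := hP
  refine ⟨hP0.image _, e.lipschitz.isBounded_image hPb,
    H.image (fun h => (h.1.comp (e.symm : F →L[ℝ] E), h.2)), ?_⟩
  ext x
  have : x ∈ e '' P ↔ e.symm x ∈ P := by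
    constructor
    · rintro ⟨y, hy, rfl⟩; simpa using hy
    · intro h; exact ⟨_, h, by simp⟩
  rw [this, hH]
  simp only [Set.mem_ofPred_eq, Finset.forall_mem_image]
  rfl

/-- The faces of a product are the products of faces. -/
theorem face_prod (P : Set E) (Q : Set F) :
    Nonempty (Face P × Face Q ≃o Face (P ×ˢ Q)) := by
  have hexp : ∀ (A : Face P) (B : Face Q), IsExposed ℝ (P ×ˢ Q) (A.1 ×ˢ B.1) := by
    rintro ⟨A, hA, hAe⟩ ⟨B, hB, hBe⟩ -
    obtain ⟨l, hl⟩ := hAe hA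
    obtain ⟨m, hm⟩ := hBe hB
    refine ⟨l.coprod m, ?_⟩
    obtain ⟨a, ha⟩ := id hA
    obtain ⟨b, hb⟩ := id hB
    have ha' := ha
    have hb' := hb
    rw [hl] at ha'
    rw [hm] at hb'
    ext ⟨x, y⟩
    simp only [Set.mem_prod, Set.mem_ofPred_eq, Prod.forall, ContinuousLinearMap.coprod_apply]
    constructor
    · rintro ⟨hx, hy⟩
      rw [hl] at hx
      rw [hm] at hy
      exact ⟨⟨hx.1, hy.1⟩, fun u v huv => add_le_add (hx.2 u huv.1) (hy.2 v huv.2)⟩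
    · rintro ⟨⟨hx, hy⟩, h⟩
      rw [hl, hm]
      exact ⟨⟨hx, fun u hu => by linarith [h u y ⟨hu, hy⟩]⟩,
        ⟨hy, fun v hv => by linarith [h x v ⟨hx, hv⟩]⟩⟩
  let f : Face P × Face Q ↪o Face (P ×ˢ Q) :=
    OrderEmbedding.ofMapLEIff
      (fun AB => ⟨AB.1.1 ×ˢ AB.2.1, AB.1.2.1.prod AB.2.2.1, hexp AB.1 AB.2⟩) (by
        rintro ⟨A, B⟩ ⟨C, D⟩
        have hne : (A.1 ×ˢ B.1).Nonempty := A.2.1.prod B.2.1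
        have := Set.prod_subset_prod_iff (s := A.1) (t := B.1) (s₁ := C.1) (t₁ := D.1)
        simp only [A.2.1.ne_empty, B.2.1.ne_empty, or_false] at this
        exact this)
  refine ⟨RelIso.ofSurjective f ?_⟩
  rintro ⟨G, hG, hGe⟩
  obtain ⟨l, hl⟩ := hGe hG
  have hsum : ∀ x y, l (x, y) = l (x, 0) + l (0, y) := fun x y => by
    rw [← map_add]; simp
  obtain ⟨⟨a, b⟩, hab⟩ := id hG
  rw [hl] at hab
  obtain ⟨⟨ha, hb⟩, hmax⟩ := hab
  have hmaxa : ∀ u ∈ P, l (u, 0) ≤ l (a, 0) := fun u hu => by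
    have := hmax (u, b) ⟨hu, hb⟩
    rw [hsum u b, hsum a b] at this
    linarith
  have hmaxb : ∀ v ∈ Q, l (0, v) ≤ l (0, b) := fun v hv => by
    have := hmax (a, v) ⟨ha, hv⟩
    rw [hsum a v, hsum a b] at this
    linarith
  refine ⟨(⟨{x ∈ P | ∀ u ∈ P, l (u, 0) ≤ l (x, 0)}, ⟨a, ha, hmaxa⟩,
      fun _ => ⟨l.comp (ContinuousLinearMap.inl ℝ E F), by simp⟩⟩,
    ⟨{y ∈ Q | ∀ v ∈ Q, l (0, v) ≤ l (0, y)}, ⟨b, hb, hmaxb⟩,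
      fun _ => ⟨l.comp (ContinuousLinearMap.inr ℝ E F), by simp⟩⟩), ?_⟩
  apply Subtype.ext
  change _ ×ˢ _ = G
  rw [hl]
  ext ⟨x, y⟩
  constructor
  · rintro ⟨⟨hx, hx'⟩, hy, hy'⟩
    refine ⟨⟨hx, hy⟩, ?_⟩
    rintro ⟨u, v⟩ ⟨hu, hv⟩
    rw [hsum u v, hsum x y]
    exact add_le_add (hx' u hu) (hy' v hv)
  · rintro ⟨⟨hx, hy⟩, h⟩
    refine ⟨⟨hx, fun u hu => ?_⟩, ⟨hy, fun v hv => ?_⟩⟩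
    · have := h (u, y) ⟨hu, hy⟩
      rw [hsum u y, hsum x y] at this
      linarith
    · have := h (x, v) ⟨hx, hv⟩
      rw [hsum x v, hsum x y] at this
      linarith

theorem face_image (P : Set E) (e : E ≃L[ℝ] F) : Nonempty (Face P ≃o Face (e '' P)) := by
  have hexp : ∀ A : Face P, IsExposed ℝ (e '' P) (e '' A.1) := by
    rintro ⟨A, hA, hAe⟩ -
    obtain ⟨l, hl⟩ := hAe hA
    refine ⟨l.comp (e.symm : F →L[ℝ] E), ?_⟩
    ext x
    simp only [Set.mem_ofPred_eq, Set.forall_mem_image]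
    constructor
    · rintro ⟨y, hy, rfl⟩
      rw [hl] at hy
      exact ⟨⟨y, hy.1, rfl⟩, fun z hz => by simpa using hy.2 z hz⟩
    · rintro ⟨⟨y, hy, rfl⟩, h⟩
      refine ⟨y, ?_, rfl⟩
      rw [hl]
      exact ⟨hy, fun z hz => by simpa using h hz⟩
  let f : Face P ↪o Face (e '' P) :=
    OrderEmbedding.ofMapLEIff (fun A => ⟨e '' A.1, A.2.1.image _, hexp A⟩)
      fun A B => Set.image_subset_image_iff e.injective
  refine ⟨RelIso.ofSurjective f ?_⟩
  rintro ⟨G, hG, hGe⟩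
  obtain ⟨l, hl⟩ := hGe hG
  have himg : e '' (e ⁻¹' G) = G := Set.image_preimage_eq _ e.surjective
  refine ⟨⟨e ⁻¹' G, ?_, fun _ => ⟨l.comp (e : E →L[ℝ] F), ?_⟩⟩, Subtype.ext himg⟩
  · rw [← himg] at hG
    exact Set.image_nonempty.1 hG
  · ext x
    rw [Set.mem_preimage, hl]
    simp

end Polytopes

section Ring

/-- A convex polytope in `ℝⁿ`. -/
structure Polytope (n : ℕ) where
  carrier : Set (Fin n → ℝ)
  isPolytope : IsPolytope carrier

/-- Two polytopes, possibly in spaces of different dimensions, are combinatorially equivalent if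
their face posets are isomorphic. -/
instance combSetoid : Setoid (Σ n, Polytope n) where
  r P Q := Nonempty (Face P.2.carrier ≃o Face Q.2.carrier)
  iseqv :=
    { refl := fun _ => ⟨OrderIso.refl _⟩
      symm := fun ⟨e⟩ => ⟨e.symm⟩
      trans := fun ⟨e⟩ ⟨f⟩ => ⟨e.trans f⟩ }

/-- Combinatorial equivalence classes of convex polytopes. -/
def CombPolytope : Type := Quotient combSetoid

/-- Concatenation of coordinates, `ℝⁿ × ℝᵐ ≃ ℝⁿ⁺ᵐ`. -/
noncomputable def appendEquiv (n m : ℕ) :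
    ((Fin n → ℝ) × (Fin m → ℝ)) ≃L[ℝ] (Fin (n + m) → ℝ) :=
  LinearEquiv.toContinuousLinearEquiv
    { Fin.appendEquiv n m with
      map_add' := fun x y => by
        ext i
        refine Fin.addCases (fun i => ?_) (fun i => ?_) i <;> simp
      map_smul' := fun c x => by
        ext i
        refine Fin.addCases (fun i => ?_) (fun i => ?_) i <;> simp }

/-- The product of two polytopes. -/
noncomputable def Polytope.prod {n m : ℕ} (P : Polytope n) (Q : Polytope m) :
    Polytope (n + m) where
  carrier := appendEquiv n m '' (P.carrier ×ˢ Q.carrier)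
  isPolytope := (P.isPolytope.prod Q.isPolytope).image _

theorem Polytope.face_prod {n m : ℕ} (P : Polytope n) (Q : Polytope m) :
    Nonempty (Face (P.prod Q).carrier ≃o Face P.carrier × Face Q.carrier) := by
  obtain ⟨e⟩ := PolytopeRing.face_prod P.carrier Q.carrier
  obtain ⟨f⟩ := face_image (P.carrier ×ˢ Q.carrier) (appendEquiv n m)
  exact ⟨f.symm.trans e.symm⟩

/-- The point, as the polytope `ℝ⁰`. -/
def Polytope.point : Polytope 0 where
  carrier := Set.univ
  isPolytope := ⟨Set.univ_nonempty, Bornology.IsBounded.all _, ∅, by simp⟩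

theorem Polytope.face_point : Nonempty (Face Polytope.point.carrier ≃o Unit) := by
  have h : ∀ A : Face Polytope.point.carrier, A.1 = Set.univ := fun A =>
    Subsingleton.eq_univ_of_nonempty A.2.1
  have : Subsingleton (Face Polytope.point.carrier) :=
    ⟨fun A B => Subtype.ext ((h A).trans (h B).symm)⟩
  have : Unique (Face Polytope.point.carrier) :=
    uniqueOfSubsingleton ⟨Set.univ, Set.univ_nonempty, IsExposed.refl _⟩
  exact ⟨OrderIso.ofUnique _ _⟩

/-- An isomorphism of products of posets from isomorphisms of the factors. -/
def prodOrderIso {α β γ δ : Type*} [LE α] [LE β] [LE γ] [LE δ] (e : α ≃o β) (f : γ ≃o δ) :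
    α × γ ≃o β × δ where
  toEquiv := e.toEquiv.prodCongr f.toEquiv
  map_rel_iff' := by simp [Prod.le_def]

/-- Combinatorial polytopes form a commutative monoid under the product, with the point as
unit. -/
noncomputable instance : CommMonoid CombPolytope where
  mul := Quotient.map₂ (fun P Q => ⟨P.1 + Q.1, P.2.prod Q.2⟩) (by
    rintro P P' ⟨e⟩ Q Q' ⟨f⟩
    obtain ⟨a⟩ := P.2.face_prod Q.2
    obtain ⟨b⟩ := P'.2.face_prod Q'.2
    exact ⟨a.trans ((prodOrderIso e f).trans b.symm)⟩)
  one := Quotient.mk _ ⟨0, Polytope.point⟩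
  mul_assoc := by
    rintro ⟨P⟩ ⟨Q⟩ ⟨R⟩
    apply Quotient.sound
    obtain ⟨a⟩ := P.2.face_prod Q.2
    obtain ⟨b⟩ := (P.2.prod Q.2).face_prod R.2
    obtain ⟨c⟩ := Q.2.face_prod R.2
    obtain ⟨d⟩ := P.2.face_prod (Q.2.prod R.2)
    exact ⟨b.trans ((prodOrderIso a (OrderIso.refl _)).trans ((OrderIso.prodAssoc _ _ _).trans
      ((prodOrderIso (OrderIso.refl _) c.symm).trans d.symm)))⟩
  one_mul := by
    rintro ⟨P⟩
    apply Quotient.sound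
    obtain ⟨a⟩ := Polytope.point.face_prod P.2
    obtain ⟨u⟩ := Polytope.face_point
    exact ⟨a.trans ((prodOrderIso u (OrderIso.refl _)).trans
      ⟨Equiv.punitProd _, by simp [Prod.le_def]⟩)⟩
  mul_one := by
    rintro ⟨P⟩
    apply Quotient.sound
    obtain ⟨a⟩ := P.2.face_prod Polytope.point
    obtain ⟨u⟩ := Polytope.face_point
    exact ⟨a.trans ((prodOrderIso (OrderIso.refl _) u).trans
      ⟨Equiv.prodPUnit _, by simp [Prod.le_def]⟩)⟩
  mul_comm := by
    rintro ⟨P⟩ ⟨Q⟩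
    apply Quotient.sound
    obtain ⟨a⟩ := P.2.face_prod Q.2
    obtain ⟨b⟩ := Q.2.face_prod P.2
    exact ⟨a.trans (OrderIso.prodComm.trans b.symm)⟩

/-- The ring of polytopes `𝔓`: the free abelian group on the combinatorial polytopes, with the
product of polytopes as multiplication. -/
abbrev PRing : Type := MonoidAlgebra ℤ CombPolytope

/-- The rational ring of polytopes `𝔓 ⊗ ℚ`, needed for exponential generating functions. -/
abbrev PRingQ : Type := MonoidAlgebra ℚ CombPolytope

/-- The inclusion of `𝔓` into `𝔓 ⊗ ℚ`. -/
noncomputable def toQ : PRing →+* PRingQ :=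
  MonoidAlgebra.mapRingHom CombPolytope (Int.castRingHom ℚ)

namespace Polytope

variable {n : ℕ} (P : Polytope n)

/-- A face of a polytope, as a polytope. -/
def face (A : Face P.carrier) : Polytope n := ⟨A.1, P.isPolytope.face A⟩

/-- The combinatorial equivalence class of a polytope. -/
def toComb : CombPolytope := Quotient.mk _ ⟨n, P⟩

/-- The element `[P]` of the ring of polytopes. -/
noncomputable def toRing : PRing :=
  MonoidAlgebra.of ℤ CombPolytope P.toComb

noncomputable instance : Fintype (Face P.carrier) :=
  haveI := P.isPolytope.finite_face
  Fintype.ofFinite _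

open Polynomial in
/-- The polynomial `F_P(t) = ∑ [f] t ^ codim f`, the sum over all nonempty faces `f` of `P`
(`P` included). -/
noncomputable def facePolynomial : PRing[X] :=
  ∑ A : Face P.carrier, C (P.face A).toRing * X ^ (dim P.carrier - dim A.1)

/-- The motivic interior `P° = F_P(-1)`. -/
noncomputable def interior : PRing := P.facePolynomial.eval (-1)

end Polytope

end Ring

section GraphAssociahedra

/-- For a graph `Γ` with vertex set `V`, `|V| = n`, the set of all `x : V → ℝ` with
`∑ x i = 3 ^ n` and `∑ i ∈ S, x i ≥ 3 ^ |S|` for every proper subset `S` of `V` that induces a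
connected (in particular nonempty) subgraph. -/
def graphAssociahedronSet {V : Type*} [Fintype V] (Γ : SimpleGraph V) : Set (V → ℝ) :=
  {x | ∑ i, x i = 3 ^ Fintype.card V ∧
    ∀ S : Finset V, S ≠ Finset.univ → (Γ.induce (S : Set V)).Connected →
      3 ^ S.card ≤ ∑ i ∈ S, x i}

theorem isPolytope_graphAssociahedronSet {V : Type*} [Fintype V] (Γ : SimpleGraph V)
    [Nonempty V] : IsPolytope (graphAssociahedronSet Γ) := by
  classical
  have hpow : ∀ k m : ℕ, 1 ≤ k → k ≤ m → (3 : ℝ) ^ k * m ≤ 3 ^ m * k := by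
    intro k m hk hkm
    induction m, hkm using Nat.le_induction with
    | base => exact le_rfl
    | succ m hm ih =>
      have h1 : (1 : ℝ) ≤ k := by exact_mod_cast hk
      have h2 : (k : ℝ) ≤ m := by exact_mod_cast hm
      have h3 : (3 : ℝ) ^ k ≤ 3 ^ m := pow_le_pow_right₀ (by norm_num) hm
      have h4 : (0 : ℝ) < 3 ^ k := by positivity
      have h5 : (0 : ℝ) < 3 ^ m := by positivity
      push_cast
      rw [pow_succ]
      nlinarith
  refine ⟨⟨fun _ => 3 ^ Fintype.card V / Fintype.card V, ?_, ?_⟩, ?_, ?_⟩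
  · have : (Fintype.card V : ℝ) ≠ 0 := by exact_mod_cast Fintype.card_ne_zero
    simp only [Finset.sum_const, Finset.card_univ, nsmul_eq_mul]
    field_simp
  · intro S _ hS
    have hS0 : 1 ≤ S.card := by
      obtain ⟨⟨v, hv⟩⟩ := hS.nonempty
      exact Finset.card_pos.2 ⟨v, hv⟩
    have hV : (0 : ℝ) < Fintype.card V := by exact_mod_cast Fintype.card_pos
    have := hpow S.card (Fintype.card V) hS0 (Finset.card_le_univ S)
    rw [Finset.sum_const, nsmul_eq_mul, mul_div_assoc', le_div_iff₀ hV]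
    linarith
  · have hpos : ∀ x ∈ graphAssociahedronSet Γ, ∀ i, 0 ≤ x i := by
      rintro x ⟨hx, hxS⟩ i
      by_cases hi : ({i} : Finset V) = Finset.univ
      · rw [← hi] at hx
        simp only [Finset.sum_singleton] at hx
        rw [hx]
        positivity
      · have hc : (Γ.induce (({i} : Finset V) : Set V)).Connected := by
          rw [Finset.coe_singleton]
          exact SimpleGraph.Connected.of_subsingleton
        have := hxS {i} hi hc
        simp only [Finset.card_singleton, Finset.sum_singleton] at this
        linarith
    refine (Metric.isBounded_Icc (0 : V → ℝ) (fun _ => 3 ^ Fintype.card V)).subset ?_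
    intro x hx
    refine ⟨fun i => hpos x hx i, fun i => ?_⟩
    have := Finset.single_le_sum (f := x) (fun j _ => hpos x hx j) (Finset.mem_univ i)
    rw [hx.1] at this
    exact this
  · let s : Finset V → ((V → ℝ) →L[ℝ] ℝ) := fun S => ∑ i ∈ S, ContinuousLinearMap.proj i
    have hs : ∀ S x, s S x = ∑ i ∈ S, x i := fun S x => by simp [s]
    refine ⟨{(s Finset.univ, 3 ^ Fintype.card V), (-s Finset.univ, -3 ^ Fintype.card V)} ∪
      (Finset.univ.filter fun S : Finset V => S ≠ Finset.univ ∧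
        (Γ.induce (S : Set V)).Connected).image fun S => (-s S, -3 ^ S.card), ?_⟩
    ext x
    constructor
    · rintro ⟨h1, h2⟩ h hh
      simp only [Finset.mem_union, Finset.mem_insert, Finset.mem_singleton, Finset.mem_image,
        Finset.mem_filter, Finset.mem_univ, true_and] at hh
      rcases hh with (rfl | rfl) | ⟨S, ⟨hS, hS'⟩, rfl⟩
      · simp [hs, h1]
      · simp [hs, h1]
      · simpa [hs] using h2 S hS hS'
    · intro h
      refine ⟨le_antisymm ?_ ?_, fun S hS hS' => ?_⟩
      · simpa [hs] using h (s Finset.univ, 3 ^ Fintype.card V) (by simp)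
      · simpa [hs] using h (-s Finset.univ, -3 ^ Fintype.card V) (by simp)
      · have := h (-s S, -3 ^ S.card) (by
          refine Finset.mem_union_right _ (Finset.mem_image.2 ⟨S, ?_, rfl⟩)
          simp only [Finset.mem_filter, Finset.mem_univ, true_and]
          exact ⟨hS, hS'⟩)
        simpa [hs] using this

/-- The graph-associahedron `P_Γ` of a connected graph `Γ` on `n` vertices. -/
def graphAssociahedron {n : ℕ} (Γ : SimpleGraph (Fin n)) (hΓ : Γ.Connected) : Polytope n where
  carrier := graphAssociahedronSet Γ
  isPolytope := haveI := hΓ.nonempty; isPolytope_graphAssociahedronSet Γ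

/-- The permutohedron `π_n`, the graph-associahedron of the complete graph on `n ≥ 1`
vertices. -/
def permutohedron (n : ℕ) [NeZero n] : Polytope n :=
  graphAssociahedron ⊤ SimpleGraph.connected_top

/-- The stellohedron `S_n`, the graph-associahedron of the star graph on `n ≥ 1` vertices. -/
def stellohedron (n : ℕ) [NeZero n] : Polytope n :=
  graphAssociahedron (SimpleGraph.starGraph 0) (SimpleGraph.connected_starGraph 0)

/-- The weighted motivic interior `π_n° = F_{π_n}(-π_1)`. -/
noncomputable def permutohedronInterior (n : ℕ) [NeZero n] : PRing :=
  (permutohedron n).facePolynomial.eval (-(permutohedron 1).toRing)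

/-- The exponential generating function `∑ a_n x ^ n / n!`. -/
noncomputable def egf (a : ℕ → PRing) : PowerSeries PRingQ :=
  PowerSeries.mk fun n => (1 / (n.factorial : ℚ)) • toQ (a n)

/-- `Π(x) = 1 + ∑_{n ≥ 1} π_n x ^ n / n!`. -/
noncomputable def permutohedronSeries : PowerSeries PRingQ :=
  1 + egf fun
    | 0 => 0
    | n + 1 => (permutohedron (n + 1)).toRing

/-- `Π°(x) = 1 - ∑_{n ≥ 1} π_n° x ^ n / n!`. -/
noncomputable def permutohedronInteriorSeries : PowerSeries PRingQ :=
  1 - egf fun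
    | 0 => 0
    | n + 1 => permutohedronInterior (n + 1)

/-- `S(x) = ∑_{n ≥ 0} S_{n+1} x ^ n / n!`. -/
noncomputable def stellohedronSeries : PowerSeries PRingQ :=
  egf fun n => (stellohedron (n + 1)).toRing

/-- `S°(x) = ∑_{n ≥ 0} S°_{n+1} x ^ n / n!`. -/
noncomputable def stellohedronInteriorSeries : PowerSeries PRingQ :=
  egf fun n => (stellohedron (n + 1)).interior

/-- The power series `e^{-x}`. -/
noncomputable def expNeg : PowerSeries PRingQ :=
  PowerSeries.rescale (-1) (PowerSeries.exp PRingQ)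

end GraphAssociahedra

end PolytopeRing

/-! The faces of `P_Γ` correspond, with order reversed, to the nested sets of `Γ` (families of
pairwise compatible proper connected vertex sets), and codimension is the number of members
(`exists_face_orderIso_nestedSets`). For the complete graph these families are chains of proper
nonempty subsets; adjoining `∅` and the whole set gives `SubsetChain n`. For the star with `n`
leaves they are pairs of a set `L` of leaves and a chain of leaf sets containing `L`, which is
`PointedSubsetChain n`.

The face attached to a nested set has as its own dual poset the nested sets refining it. A
refinement of a chain is cut at a member into independent pieces, and intervals of a Boolean lattice
are Boolean lattices. Hence faces of permutohedra are products of permutohedra, and faces of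
stellohedra are products of one stellohedron and permutohedra.

The motivic interiors thus become signed sums over chains. Sorting the chains from `∅` to the whole
set by their second smallest member gives a recursion (`chainSum_eq_neg_sum`) which says `Π Π° = 1`.
Sorting the pairs `(L, C)` by the least member `A` of `C` (`sum_pointedChain`) writes the interior
of the stellohedron as a sum over `L ⊆ A`. The choice of `L` inside `A` contributes `e^{-x} S`, and
the chain above `A` contributes `Π°`. With `egf_mul` this is the first equality, and invertibility
of `Π` gives the second. -/

namespace PolytopeRing

/-! ### Faces of sets cut out by linear inequalities. -/

section Geometry

variable {E : Type*} [NormedAddCommGroup E] [NormedSpace ℝ E] {ι : Type*}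

/-- The set cut out by one linear equation and finitely many linear inequalities. -/
def halfspaceInter (l₀ : E →L[ℝ] ℝ) (c₀ : ℝ) (s : Finset ι) (l : ι → E →L[ℝ] ℝ) (c : ι → ℝ) :
    Set E :=
  {x | l₀ x = c₀ ∧ ∀ i ∈ s, l i x ≤ c i}

/-- The inequalities that are equalities at `x`. -/
noncomputable def tightSet (s : Finset ι) (l : ι → E →L[ℝ] ℝ) (c : ι → ℝ) (x : E) : Finset ι :=
  open Classical in s.filter fun i => l i x = c i

variable {l₀ : E →L[ℝ] ℝ} {c₀ : ℝ} {s : Finset ι} {l : ι → E →L[ℝ] ℝ} {c : ι → ℝ}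

theorem mem_tightSet {x : E} {i : ι} : i ∈ tightSet s l c x ↔ i ∈ s ∧ l i x = c i := by
  simp [tightSet]

/-- Moving slightly from `x` in a direction that preserves the equation and the tight inequalities
stays inside. -/
theorem exists_add_smul_mem {x v : E} (hx : x ∈ halfspaceInter l₀ c₀ s l c) (hv : l₀ v = 0)
    (hvt : ∀ i ∈ tightSet s l c x, l i v = 0) :
    ∃ ε : ℝ, 0 < ε ∧ x + ε • v ∈ halfspaceInter l₀ c₀ s l c := by
  have hev : ∀ᶠ ε : ℝ in nhdsWithin 0 (Set.Ioi 0), ∀ i ∈ s, l i (x + ε • v) ≤ c i := by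
    rw [Filter.eventually_all_finset]
    intro i hi
    by_cases heq : l i x = c i
    · have := hvt i (mem_tightSet.2 ⟨hi, heq⟩)
      exact Filter.Eventually.of_forall fun ε => by simp [heq, this]
    · have hlt : l i (x + (0 : ℝ) • v) < c i := by
        simpa using lt_of_le_of_ne (hx.2 i hi) heq
      have hc : Continuous fun ε : ℝ => l i (x + ε • v) := by fun_prop
      have := (hc.tendsto 0).eventually_lt_const hlt
      exact (this.filter_mono nhdsWithin_le_nhds).mono fun ε h => h.le
  obtain ⟨ε, h1, h2⟩ := (hev.and self_mem_nhdsWithin).exists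
  exact ⟨ε, h2, by simp [hv, hx.1], h1⟩

/-- The part of a set cut out by linear inequalities on which the inequalities in `N` are tight. -/
def tightFace (l₀ : E →L[ℝ] ℝ) (c₀ : ℝ) (s : Finset ι) (l : ι → E →L[ℝ] ℝ) (c : ι → ℝ)
    (N : Finset ι) : Set E :=
  {x | x ∈ halfspaceInter l₀ c₀ s l c ∧ ∀ i ∈ N, l i x = c i}

theorem subset_tightSet_of_mem_tightFace {N : Finset ι} (hN : N ⊆ s) {x : E}
    (hx : x ∈ tightFace l₀ c₀ s l c N) : N ⊆ tightSet s l c x :=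
  fun i hi => mem_tightSet.2 ⟨hN hi, hx.2 i hi⟩

/-- Take `a` in `A` with the fewest tight inequalities. The midpoint of `a` and any `y` in `A` is
tight only where both are, so by minimality everything tight at `a` is tight at `y`. Conversely, if
everything tight at `a` is tight at `y`, one can move slightly from `a` away from `y` inside the
set, so the functional exposing `A` is no smaller at `y`. -/
theorem exists_eq_tightFace {A : Set E} (hA : A.Nonempty)
    (hexp : IsExposed ℝ (halfspaceInter l₀ c₀ s l c) A) :
    ∃ a ∈ A, A = tightFace l₀ c₀ s l c (tightSet s l c a) := by
  classical
  obtain ⟨m, hm⟩ := hexp hA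
  obtain ⟨a, haA, hmin⟩ : ∃ a ∈ A, ∀ b ∈ A, (tightSet s l c a).card ≤ (tightSet s l c b).card := by
    obtain ⟨k, ⟨a, ha, rfl⟩, hk⟩ := WellFounded.has_min (wellFounded_lt (α := ℕ))
      ((fun a => (tightSet s l c a).card) '' A) (hA.image _)
    exact ⟨a, ha, fun b hb => not_lt.1 (hk _ ⟨b, hb, rfl⟩)⟩
  have haP := hexp.subset haA
  refine ⟨a, haA, ?_⟩
  ext y
  constructor
  · intro hy
    have hyP := hexp.subset hy
    refine ⟨hyP, ?_⟩
    have hmid : ∀ f : E →L[ℝ] ℝ, f ((1 / 2 : ℝ) • a + (1 / 2 : ℝ) • y) = (f a + f y) / 2 := by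
      intro f; simp; ring
    have hzA : (1 / 2 : ℝ) • a + (1 / 2 : ℝ) • y ∈ A := by
      have ha' := haA
      rw [hm] at ha' hy ⊢
      refine ⟨⟨?_, fun i hi => ?_⟩, fun w hw => ?_⟩
      · rw [hmid, haP.1, hyP.1]; ring
      · rw [hmid]; linarith [haP.2 i hi, hyP.2 i hi]
      · rw [hmid]; linarith [ha'.2 w hw, hy.2 w hw]
    have hsub : tightSet s l c ((1 / 2 : ℝ) • a + (1 / 2 : ℝ) • y) ⊆
        tightSet s l c a ∩ tightSet s l c y := by
      intro i hi
      rw [mem_tightSet, hmid] at hi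
      rw [Finset.mem_inter, mem_tightSet, mem_tightSet]
      have h1 := haP.2 i hi.1
      have h2 := hyP.2 i hi.1
      exact ⟨⟨hi.1, by linarith [hi.2]⟩, hi.1, by linarith [hi.2]⟩
    have heq := Finset.eq_of_subset_of_card_le (hsub.trans Finset.inter_subset_left) (hmin _ hzA)
    intro i hi
    rw [← heq] at hi
    exact (mem_tightSet.1 (Finset.mem_inter.1 (hsub hi)).2).2
  · rintro ⟨hyP, hy⟩
    obtain ⟨ε, hε, hmem⟩ := exists_add_smul_mem (v := a - y) haP
      (by rw [map_sub, haP.1, hyP.1, sub_self])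
      (fun i hi => by rw [map_sub, hy i hi, (mem_tightSet.1 hi).2, sub_self])
    have ha2 := haA
    rw [hm] at ha2
    have hle := ha2.2 _ hmem
    simp only [map_add, map_smul, map_sub, smul_eq_mul] at hle
    have hya : m a ≤ m y := by
      by_contra hlt
      push Not at hlt
      nlinarith [mul_pos hε (sub_pos.2 hlt)]
    rw [hm]
    exact ⟨hyP, fun z hz => (ha2.2 z hz).trans hya⟩

/-- The sum of the functionals in `N` is bounded by the sum of their bounds, with equality only if
each one is tight. A point of the face, available because exposedness assumes nonemptiness, shows
that the bound is attained. -/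
theorem isExposed_tightFace {N : Finset ι} (hN : N ⊆ s) :
    IsExposed ℝ (halfspaceInter l₀ c₀ s l c) (tightFace l₀ c₀ s l c N) := by
  rintro ⟨a, ha⟩
  refine ⟨∑ i ∈ N, l i, ?_⟩
  ext x
  simp only [_root_.sum_apply, Set.mem_ofPred_eq]
  constructor
  · rintro ⟨hx, hxN⟩
    refine ⟨hx, fun y hy => Finset.sum_le_sum fun i hi => ?_⟩
    rw [hxN i hi]
    exact hy.2 i (hN hi)
  · rintro ⟨hx, h⟩
    refine ⟨hx, ?_⟩
    have h1 := h a ha.1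
    rw [Finset.sum_congr rfl ha.2] at h1
    exact (Finset.sum_eq_sum_iff_of_le fun i hi => hx.2 i (hN hi)).1
      (le_antisymm (Finset.sum_le_sum fun i hi => hx.2 i (hN hi)) h1)

/-- An exposed face of an exposed face of a polytope is an exposed face. -/
theorem IsPolytope.isExposed_trans {P A B : Set E} (hP : IsPolytope P) (hA : IsExposed ℝ P A)
    (hB : IsExposed ℝ A B) : IsExposed ℝ P B := by
  classical
  rintro hBne
  obtain ⟨-, -, H, hH⟩ := hP
  obtain ⟨a, haB⟩ := id hBne
  have haA : a ∈ A := hB.subset haB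
  obtain ⟨m, hm⟩ := hA ⟨a, haA⟩
  have haA' := haA
  rw [hm] at haA'
  have hAeq : A = halfspaceInter m (m a) H Prod.fst Prod.snd := by
    ext x
    rw [hm]
    constructor
    · rintro ⟨hx, h⟩
      refine ⟨le_antisymm (haA'.2 x hx) (h a haA'.1), ?_⟩
      rw [hH] at hx
      exact hx
    · rintro ⟨h1, h2⟩
      refine ⟨by rw [hH]; exact h2, fun y hy => ?_⟩
      rw [h1]
      exact haA'.2 y hy
  rw [hAeq] at hB
  obtain ⟨b, hbB, hBeq⟩ := exists_eq_tightFace hBne hB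
  set N := tightSet H Prod.fst Prod.snd b
  have hN : N ⊆ H := Finset.filter_subset _ _
  -- No large multiple of `m` is needed: `B` is described by inequalities valid on all of `P`, so
  -- every summand is bounded on `P` and all bounds are attained together exactly on `B`.
  refine ⟨m + ∑ h ∈ N, h.1, ?_⟩
  have key : ∀ y ∈ P, m y ≤ m a ∧ ∀ h ∈ N, h.1 y ≤ h.2 := fun y hy =>
    ⟨haA'.2 y hy, fun h hh => by rw [hH] at hy; exact hy h (hN hh)⟩
  have haN : ∀ h ∈ N, h.1 a = h.2 := by
    rw [hBeq] at haB
    exact haB.2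
  ext x
  simp only [add_apply, _root_.sum_apply, Set.mem_ofPred_eq]
  constructor
  · intro hx
    rw [hBeq] at hx
    refine ⟨hA.subset (by rw [hAeq]; exact hx.1), fun y hy => ?_⟩
    rw [hx.1.1, Finset.sum_congr rfl hx.2]
    exact add_le_add (key y hy).1 (Finset.sum_le_sum (key y hy).2)
  · rintro ⟨hx, h⟩
    have h1 := h a haA'.1
    rw [Finset.sum_congr rfl haN] at h1
    have h2 := Finset.sum_le_sum (key x hx).2
    have h3 := (key x hx).1
    rw [hBeq]
    refine ⟨⟨by linarith, by rw [hH] at hx; exact hx⟩, ?_⟩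
    exact (Finset.sum_eq_sum_iff_of_le (key x hx).2).1 (by linarith)

/-- The faces of a face `A` are the faces contained in `A`. -/
theorem IsPolytope.face_face {P : Set E} (hP : IsPolytope P) (A : Face P) :
    Nonempty (Face A.1 ≃o Set.Iic A) := by
  have hA := A.2.2
  refine ⟨{ toFun := fun B => ⟨⟨B.1, B.2.1, hP.isExposed_trans hA B.2.2⟩, B.2.2.subset⟩
            invFun := fun B => ⟨B.1.1, B.1.2.1, fun hne => ?_⟩
            left_inv := fun B => rfl
            right_inv := fun B => rfl
            map_rel_iff' := Iff.rfl }⟩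
  obtain ⟨m, hm⟩ := B.1.2.2 hne
  have hBA : B.1.1 ⊆ A.1 := B.2
  obtain ⟨b, hb⟩ := hne
  refine ⟨m, ?_⟩
  ext x
  constructor
  · intro hx
    refine ⟨hBA hx, fun y hy => ?_⟩
    rw [hm] at hx
    exact hx.2 y (hA.subset hy)
  · rintro ⟨hx, h⟩
    have h1 := h b (hBA hb)
    rw [hm] at hb ⊢
    exact ⟨hA.subset hx, fun y hy => (hb.2 y hy).trans h1⟩

/-- Functionals that are constant on the face vanish on differences of its points; conversely, a
small positive multiple of such a `v` added to `x` stays in the face. -/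
theorem vectorSpan_tightFace {x : E} (hx : x ∈ halfspaceInter l₀ c₀ s l c) {v : E} :
    v ∈ vectorSpan ℝ (tightFace l₀ c₀ s l c (tightSet s l c x)) ↔
      l₀ v = 0 ∧ ∀ i ∈ tightSet s l c x, l i v = 0 := by
  have hxF : x ∈ tightFace l₀ c₀ s l c (tightSet s l c x) :=
    ⟨hx, fun i hi => (mem_tightSet.1 hi).2⟩
  constructor
  · intro hv
    have key : ∀ f : E →L[ℝ] ℝ, ∀ r : ℝ,
        (∀ y ∈ tightFace l₀ c₀ s l c (tightSet s l c x), f y = r) → f v = 0 := by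
      intro f r hf
      have hle : vectorSpan ℝ (tightFace l₀ c₀ s l c (tightSet s l c x)) ≤
          LinearMap.ker (f : E →ₗ[ℝ] ℝ) := by
        rw [vectorSpan, Submodule.span_le]
        rintro _ ⟨y, hy, z, hz, rfl⟩
        simp [hf y hy, hf z hz]
      simpa using hle hv
    exact ⟨key l₀ c₀ fun y hy => hy.1.1, fun i hi => key (l i) (c i) fun y hy => hy.2 i hi⟩
  · rintro ⟨hv, hvt⟩
    obtain ⟨ε, hε, hmem⟩ := exists_add_smul_mem hx hv hvt
    have hmem' : x + ε • v ∈ tightFace l₀ c₀ s l c (tightSet s l c x) :=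
      ⟨hmem, fun i hi => by simp [hvt i hi, (mem_tightSet.1 hi).2]⟩
    have := vsub_mem_vectorSpan ℝ hmem' hxF
    rw [vsub_eq_sub, add_sub_cancel_left] at this
    exact (Submodule.smul_mem_iff _ hε.ne').1 this

/-- If the tight sets of the points of a set cut out by linear inequalities form a simplicial
complex `𝒩`, then its face poset is the opposite of `𝒩`, and codimension is cardinality. -/
theorem exists_face_orderIso [FiniteDimensional ℝ E] (𝒩 : Set (Finset ι)) (hlow : IsLowerSet 𝒩)
    (htight : ∀ x ∈ halfspaceInter l₀ c₀ s l c, tightSet s l c x ∈ 𝒩)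
    (hpoint : ∀ N ∈ 𝒩, ∃ x ∈ halfspaceInter l₀ c₀ s l c, tightSet s l c x = N) :
    ∃ e : Face (halfspaceInter l₀ c₀ s l c) ≃o 𝒩ᵒᵈ, ∀ A,
      dim (halfspaceInter l₀ c₀ s l c) - dim A.1 = (OrderDual.ofDual (e A)).1.card := by
  classical
  have hsub : ∀ N ∈ 𝒩, N ⊆ s := by
    intro N hN
    obtain ⟨x, -, rfl⟩ := hpoint N hN
    exact Finset.filter_subset _ _
  choose! p hpP hpt using hpoint
  have hpF : ∀ N ∈ 𝒩, p N ∈ tightFace l₀ c₀ s l c N := fun N hN =>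
    ⟨hpP N hN, fun i hi => by rw [← hpt N hN] at hi; exact (mem_tightSet.1 hi).2⟩
  let f : 𝒩ᵒᵈ ↪o Face (halfspaceInter l₀ c₀ s l c) :=
    OrderEmbedding.ofMapLEIff
      (fun N => ⟨tightFace l₀ c₀ s l c (OrderDual.ofDual N).1,
        ⟨_, hpF _ (OrderDual.ofDual N).2⟩, isExposed_tightFace (hsub _ (OrderDual.ofDual N).2)⟩)
      (by
        intro N M
        obtain ⟨N, hN⟩ := N
        obtain ⟨M, hM⟩ := M
        constructor
        · intro h
          have h1 := subset_tightSet_of_mem_tightFace (hsub M hM) (h (hpF N hN))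
          rw [hpt N hN] at h1
          exact h1
        · intro h x hx
          exact ⟨hx.1, fun i hi => hx.2 i (h hi)⟩)
  have hf : Function.Surjective f := by
    rintro ⟨A, hA, hexp⟩
    obtain ⟨a, ha, heq⟩ := exists_eq_tightFace hA hexp
    exact ⟨OrderDual.toDual ⟨_, htight a (hexp.subset ha)⟩, Subtype.ext heq.symm⟩
  let e := RelIso.ofSurjective f hf
  refine ⟨OrderIso.symm e, fun A => ?_⟩
  obtain ⟨N, rfl⟩ := e.surjective A
  rw [show OrderIso.symm e (e N) = N from e.symm_apply_apply N]
  obtain ⟨N, hN⟩ := N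
  change dim (halfspaceInter l₀ c₀ s l c) - dim (tightFace l₀ c₀ s l c N) = N.card
  have h0 : (∅ : Finset ι) ∈ 𝒩 := hlow (Finset.empty_subset N) hN
  have hfull : halfspaceInter l₀ c₀ s l c = tightFace l₀ c₀ s l c ∅ := by
    ext x; simp [tightFace]
  have hW : ∀ M ∈ 𝒩, ∀ v, v ∈ vectorSpan ℝ (tightFace l₀ c₀ s l c M) ↔
      l₀ v = 0 ∧ ∀ i ∈ M, l i v = 0 := by
    intro M hM v
    have := vectorSpan_tightFace (hpP M hM) (v := v)
    rwa [hpt M hM] at this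
  set W := vectorSpan ℝ (halfspaceInter l₀ c₀ s l c) with hWdef
  have hW0 : ∀ v, v ∈ W ↔ l₀ v = 0 := by
    intro v
    rw [hWdef, hfull, hW ∅ h0]
    simp
  -- The kernel is the direction space of the face, so the codimension is `N.card` once `φ` is onto.
  let φ : W →ₗ[ℝ] (N → ℝ) :=
    LinearMap.pi fun i => (l i.1 : E →ₗ[ℝ] ℝ) ∘ₗ W.subtype
  have hφ : ∀ (w : W) (i : N), φ w i = l i.1 w.1 := fun _ _ => rfl
  have hker : (LinearMap.ker φ).map W.subtype = vectorSpan ℝ (tightFace l₀ c₀ s l c N) := by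
    ext v
    rw [hW N hN]
    simp only [Submodule.mem_map, LinearMap.mem_ker, Submodule.subtype_apply, Subtype.exists,
      exists_and_right, exists_eq_right]
    constructor
    · rintro ⟨hv, h⟩
      exact ⟨(hW0 v).1 hv, fun i hi => by simpa [hφ] using congrFun h ⟨i, hi⟩⟩
    · rintro ⟨hv, h⟩
      exact ⟨(hW0 v).2 hv, funext fun i => by simpa [hφ] using h i.1 i.2⟩
  have hsurj : Function.Surjective φ := by
    have hdual : ∀ i : N, ∃ w : W, φ w = Pi.single i 1 := by
      rintro ⟨i, hi⟩
      -- The simplicial complex supplies a point where exactly `N.erase i` is tight. Its difference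
      -- from `p N` is killed by every functional of `N` except the one for `i`.
      have hNi : N.erase i ∈ 𝒩 := hlow (Finset.erase_subset i N) hN
      have hne : l i (p (N.erase i)) ≠ c i := by
        intro h
        have : i ∈ tightSet s l c (p (N.erase i)) := mem_tightSet.2 ⟨hsub N hN hi, h⟩
        rw [hpt _ hNi] at this
        simp at this
      have hu : p (N.erase i) - p N ∈ W := by
        rw [hW0, map_sub, (hpP _ hNi).1, (hpP _ hN).1, sub_self]
      have hui : l i (p (N.erase i) - p N) ≠ 0 := by
        rw [map_sub, (hpF N hN).2 i hi]
        exact sub_ne_zero.2 hne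
      refine ⟨(l i (p (N.erase i) - p N))⁻¹ • ⟨_, hu⟩, ?_⟩
      rw [map_smul]
      ext ⟨j, hj⟩
      rw [Pi.smul_apply, hφ]
      by_cases hij : j = i
      · subst hij
        simp only [Pi.single_eq_same, smul_eq_mul]
        exact inv_mul_cancel₀ hui
      · have : l j (p (N.erase i) - p N) = 0 := by
          rw [map_sub, (hpF N hN).2 j hj, (hpF _ hNi).2 j (Finset.mem_erase.2 ⟨hij, hj⟩), sub_self]
        rw [Pi.single_eq_of_ne (by simpa using hij)]
        simp only [this, smul_zero]
    choose w hw using hdual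
    intro y
    refine ⟨∑ i, y i • w i, ?_⟩
    rw [map_sum]
    simp only [map_smul, hw]
    ext j
    simp [Finset.sum_apply, Pi.single_apply]
  have hrank := LinearMap.finrank_range_add_finrank_ker φ
  rw [LinearMap.range_eq_top.2 hsurj, finrank_top, Module.finrank_fintype_fun_eq_card,
    Fintype.card_coe] at hrank
  have hk : Module.finrank ℝ (LinearMap.ker φ) = dim (tightFace l₀ c₀ s l c N) := by
    rw [dim, ← hker]
    exact (LinearEquiv.finrank_eq
      (Submodule.equivMapOfInjective W.subtype W.injective_subtype _))
  have hd : dim (halfspaceInter l₀ c₀ s l c) = Module.finrank ℝ W := rfl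
  omega

end Geometry

end PolytopeRing

namespace PolytopeRing

/-! ### The faces of graph-associahedra and nested sets. -/

section NestedSets

variable {V : Type*} {Γ : SimpleGraph V}

/-- Pairwise compatibility of connected vertex sets: two members are comparable, or their union is
not connected. -/
def IsNested (Γ : SimpleGraph V) (N : Finset (Finset V)) : Prop :=
  (∀ S ∈ N, (Γ.induce (S : Set V)).Connected) ∧
    ∀ S ∈ N, ∀ T ∈ N, S ⊆ T ∨ T ⊆ S ∨ ¬ (Γ.induce (S ∪ T : Set V)).Connected

theorem IsNested.subset {N M : Finset (Finset V)} (hN : IsNested Γ N) (h : M ⊆ N) :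
    IsNested Γ M :=
  ⟨fun S hS => hN.1 S (h hS), fun S hS T hT => hN.2 S (h hS) T (h hT)⟩

theorem connected_union_of_mem {S T : Finset V} (hS : (Γ.induce (S : Set V)).Connected)
    (hT : (Γ.induce (T : Set V)).Connected) {v : V} (hvS : v ∈ S) (hvT : v ∈ T) :
    (Γ.induce (S ∪ T : Set V)).Connected :=
  SimpleGraph.induce_union_connected hS.preconnected hT.preconnected ⟨v, hvS, hvT⟩

theorem connected_union_of_adj {S T : Finset V} (hS : (Γ.induce (S : Set V)).Connected)
    (hT : (Γ.induce (T : Set V)).Connected) {u v : V} (hu : u ∈ S) (hv : v ∈ T)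
    (huv : Γ.Adj u v) : (Γ.induce (S ∪ T : Set V)).Connected :=
  SimpleGraph.connected_induce_union hS.preconnected hT.preconnected hu hv huv

theorem IsNested.disjoint {N : Finset (Finset V)} (hN : IsNested Γ N) {S T : Finset V}
    (hS : S ∈ N) (hT : T ∈ N) : S ⊆ T ∨ T ⊆ S ∨ Disjoint S T := by
  rcases hN.2 S hS T hT with h | h | h
  · exact Or.inl h
  · exact Or.inr (Or.inl h)
  · refine Or.inr (Or.inr (Finset.disjoint_left.2 fun v hvS hvT => h ?_))
    exact connected_union_of_mem (hN.1 S hS) (hN.1 T hT) hvS hvT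

theorem exists_adj_of_connected {T : Finset V} (hT : (Γ.induce (T : Set V)).Connected)
    {R : Finset V} {u v : V} (hu : u ∈ T) (hv : v ∈ T) (huR : u ∈ R) (hvR : v ∉ R) :
    ∃ a ∈ T, ∃ b ∈ T, a ∈ R ∧ b ∉ R ∧ Γ.Adj a b := by
  obtain ⟨p⟩ := hT.preconnected ⟨u, hu⟩ ⟨v, hv⟩
  obtain ⟨d, -, h1, h2⟩ := p.exists_boundary_dart {x | x.1 ∈ R} huR hvR
  exact ⟨d.fst.1, d.fst.2, d.snd.1, d.snd.2, h1, h2, d.adj⟩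

/-- A connected set covered by members of a nested set is contained in one of them. -/
theorem IsNested.exists_superset {N : Finset (Finset V)} (hN : IsNested Γ N) {T : Finset V}
    (hT : (Γ.induce (T : Set V)).Connected) (hcov : ∀ v ∈ T, ∃ R ∈ N, v ∈ R) :
    ∃ R ∈ N, T ⊆ R := by
  classical
  obtain ⟨⟨t, ht⟩⟩ := hT.nonempty
  obtain ⟨R₀, hR₀, htR₀⟩ := hcov t ht
  -- If the largest member `R` meeting `T` misses part of `T`, an edge inside `T` leads from `R` to
  -- another member `R'`. Then `R ∪ R'` is connected, so the two are comparable, against the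
  -- maximality of `R` or the choice of the edge.
  obtain ⟨R, hR, hmax⟩ := Finset.exists_max_image (N.filter fun R => ∃ v ∈ T, v ∈ R) Finset.card
    ⟨R₀, Finset.mem_filter.2 ⟨hR₀, t, ht, htR₀⟩⟩
  obtain ⟨hRN, u, huT, huR⟩ := Finset.mem_filter.1 hR
  refine ⟨R, hRN, fun v hv => ?_⟩
  by_contra hvR
  obtain ⟨a, haT, b, hbT, haR, hbR, hab⟩ := exists_adj_of_connected hT huT hv huR hvR
  obtain ⟨R', hR'N, hbR'⟩ := hcov b hbT
  rcases hN.2 R hRN R' hR'N with h | h | h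
  · have hlt : R.card < R'.card := Finset.card_lt_card ⟨h, fun h' => hbR (h' hbR')⟩
    exact absurd (hmax R' (Finset.mem_filter.2 ⟨hR'N, b, hbT, hbR'⟩)) (not_le.2 hlt)
  · exact hbR (h hbR')
  · exact h (connected_union_of_adj (hN.1 R hRN) (hN.1 R' hR'N) haR hbR' hab)

open Classical in
/-- The union of the members of `N` properly contained in `S`. -/
noncomputable def innerUnion (N : Finset (Finset V)) (S : Finset V) : Finset V :=
  (N.filter (· ⊂ S)).biUnion id

theorem mem_innerUnion {N : Finset (Finset V)} {S : Finset V} {v : V} :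
    v ∈ innerUnion N S ↔ ∃ R ∈ N, R ⊂ S ∧ v ∈ R := by
  simp [innerUnion, and_assoc]

theorem innerUnion_subset (N : Finset (Finset V)) (S : Finset V) : innerUnion N S ⊆ S := by
  intro v hv
  obtain ⟨R, -, hRS, hvR⟩ := mem_innerUnion.1 hv
  exact hRS.1 hvR

theorem IsNested.exists_ssuperset {N : Finset (Finset V)} (hN : IsNested Γ N) {S T : Finset V}
    (hT : (Γ.induce (T : Set V)).Connected) (h : T ⊆ innerUnion N S) :
    ∃ R ∈ N, R ⊂ S ∧ T ⊆ R := by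
  classical
  obtain ⟨R, hR, hTR⟩ := (hN.subset (Finset.filter_subset (· ⊂ S) N)).exists_superset hT
    (fun v hv => by
      obtain ⟨R, hR, hRS, hvR⟩ := mem_innerUnion.1 (h hv)
      exact ⟨R, Finset.mem_filter.2 ⟨hR, hRS⟩, hvR⟩)
  rw [Finset.mem_filter] at hR
  exact ⟨R, hR.1, hR.2, hTR⟩

-- A connected set covered by strictly smaller members would lie inside one of them.
open Classical in
theorem IsNested.card_sdiff_innerUnion_pos {N : Finset (Finset V)} (hN : IsNested Γ N)
    {S : Finset V} (hS : S ∈ N) : 0 < (S \ innerUnion N S).card := by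
  rw [Finset.card_pos, Finset.sdiff_nonempty]
  intro h
  obtain ⟨R, -, hRS, hSR⟩ := hN.exists_ssuperset (hN.1 S hS) h
  exact hRS.2 hSR

open Classical in
/-- A point lying on all the hyperplanes of a nested set, with the excess of every member spread
evenly over the vertices that are in no smaller member. -/
theorem IsNested.exists_even_point {N : Finset (Finset V)} (hN : IsNested Γ N) :
    ∃ x : V → ℝ, ∀ S ∈ N, ∑ i ∈ S, x i = 3 ^ S.card ∧
      ∀ i ∈ S \ innerUnion N S, ∀ j ∈ S \ innerUnion N S, x i = x j := by
  -- Members are inserted by increasing size. The vertices of `A \ U` then lie in no earlier member,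
  -- so their values can be reset without disturbing earlier equations.
  induction N using Finset.induction_on_max_value (fun S : Finset V => S.card) with
  | empty => exact ⟨0, by simp⟩
  | insert A N hA hmax ih =>
    obtain ⟨x, hx⟩ := ih (hN.subset (Finset.subset_insert _ _))
    have hpos := hN.card_sdiff_innerUnion_pos (Finset.mem_insert_self A N)
    set U := innerUnion (insert A N) A with hU
    have hUA : U ⊆ A := innerUnion_subset _ _
    have hinner : ∀ S ∈ N, innerUnion (insert A N) S = innerUnion N S := by
      intro S hS
      ext v
      simp only [mem_innerUnion, Finset.mem_insert, exists_eq_or_imp, or_iff_right_iff_imp]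
      rintro ⟨h, -⟩
      exact absurd (Finset.card_lt_card h) (not_lt.2 (hmax S hS))
    have hdisj : ∀ S ∈ N, ∀ v ∈ S, v ∉ A \ U := by
      intro S hS v hv hvA
      obtain ⟨hvA, hvU⟩ := Finset.mem_sdiff.1 hvA
      rcases hN.disjoint (Finset.mem_insert_of_mem hS) (Finset.mem_insert_self A N) with h | h | h
      · refine hvU (mem_innerUnion.2 ⟨S, Finset.mem_insert_of_mem hS, ⟨h, fun h' => ?_⟩, hv⟩)
        exact hA ((h'.antisymm h) ▸ hS)
      · exact hA ((Finset.eq_of_subset_of_card_le h (hmax S hS)) ▸ hS)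
      · exact Finset.disjoint_left.1 h hv hvA
    set r : ℝ := (3 ^ A.card - ∑ i ∈ U, x i) / (A \ U).card with hr
    refine ⟨fun i => if i ∈ A \ U then r else x i, fun S hS => ?_⟩
    rcases Finset.mem_insert.1 hS with rfl | hS
    · constructor
      · rw [← Finset.sum_sdiff hUA, Finset.sum_congr rfl fun i hi => if_pos hi,
          Finset.sum_congr (s₁ := U) rfl fun i hi => if_neg fun h => (Finset.mem_sdiff.1 h).2 hi,
          Finset.sum_const, nsmul_eq_mul, hr]
        have : ((S \ U).card : ℝ) ≠ 0 := by exact_mod_cast hpos.ne'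
        field_simp
        ring
      · intro i hi j hj
        exact (if_pos hi).trans (if_pos hj).symm
    · rw [hinner S hS]
      constructor
      · rw [Finset.sum_congr rfl fun i hi => if_neg (hdisj S hS i hi)]
        exact (hx S hS).1
      · intro i hi j hj
        exact (if_neg (hdisj S hS i (Finset.mem_sdiff.1 hi).1)).trans (((hx S hS).2 i hi j hj).trans
          (if_neg (hdisj S hS j (Finset.mem_sdiff.1 hj).1)).symm)

-- The maximal members are disjoint and sum to powers of `3`, and `3 ^ a + 3 ^ b ≤ 3 ^ (a + b)` for
-- `a, b ≥ 1`. The induction inserts a smallest member, which is either contained in another one or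
-- disjoint from all the others.
open Classical in
theorem IsNested.sum_biUnion_le {N : Finset (Finset V)} (hN : IsNested Γ N) {x : V → ℝ}
    (hx : ∀ S ∈ N, ∑ i ∈ S, x i = 3 ^ S.card) :
    ∑ i ∈ N.biUnion id, x i ≤ 3 ^ (N.biUnion id).card := by
  induction N using Finset.induction_on_min_value (fun S : Finset V => S.card) with
  | empty => simp
  | insert A N hA hmin ih =>
    have ih := ih (hN.subset (Finset.subset_insert _ _))
      fun S hS => hx S (Finset.mem_insert_of_mem hS)
    rw [Finset.biUnion_insert, id]
    by_cases hsub : ∃ S ∈ N, A ⊆ S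
    · obtain ⟨S, hS, hAS⟩ := hsub
      have : A ∪ N.biUnion id = N.biUnion id :=
        Finset.union_eq_right.2 fun v hv => Finset.mem_biUnion.2 ⟨S, hS, hAS hv⟩
      rwa [this]
    · push Not at hsub
      have hdisj : Disjoint A (N.biUnion id) := by
        rw [Finset.disjoint_biUnion_right]
        intro S hS
        rcases hN.disjoint (Finset.mem_insert_self A N) (Finset.mem_insert_of_mem hS) with h | h | h
        · exact absurd h (hsub S hS)
        · exact absurd (Finset.eq_of_subset_of_card_le h (hmin S hS)).superset (hsub S hS)
        · exact h
      rw [Finset.sum_union hdisj, hx A (Finset.mem_insert_self _ _), Finset.card_union_of_disjoint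
        hdisj]
      rcases N.eq_empty_or_nonempty with rfl | ⟨S, hS⟩
      · simp
      · have hS0 : 1 ≤ (N.biUnion id).card := by
          obtain ⟨⟨v, hv⟩⟩ := (hN.1 S (Finset.mem_insert_of_mem hS)).nonempty
          exact Finset.card_pos.2 ⟨v, Finset.mem_biUnion.2 ⟨S, hS, hv⟩⟩
        have hA0 : 1 ≤ A.card := by
          obtain ⟨⟨v, hv⟩⟩ := (hN.1 A (Finset.mem_insert_self _ _)).nonempty
          exact Finset.card_pos.2 ⟨v, hv⟩
        refine (add_le_add_right ih _).trans ?_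
        have h1 : (3 : ℝ) ^ 1 ≤ 3 ^ A.card := pow_le_pow_right₀ (by norm_num) hA0
        have h2 : (3 : ℝ) ^ 1 ≤ 3 ^ (N.biUnion id).card := pow_le_pow_right₀ (by norm_num) hS0
        rw [pow_add]
        nlinarith

/-- This compares `a` shares of an excess `3 ^ m - 1` spread evenly over `m` vertices with `3 ^ a`.
With base `2` it would fail at `a = 1`, `m = 2`. -/
theorem mul_three_pow_lt {a m : ℕ} (ha : 1 ≤ a) (ham : a < m) :
    (m : ℝ) * 3 ^ a < a * (3 ^ m - 1) := by
  have ha' : (1 : ℝ) ≤ a := by exact_mod_cast ha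
  have h1 : (1 : ℝ) ≤ 3 ^ a := one_le_pow₀ (by norm_num)
  induction m, ham using Nat.le_induction with
  | base =>
    have h3 : (3 : ℝ) ^ 1 ≤ 3 ^ a := pow_le_pow_right₀ (by norm_num) ha
    push_cast
    rw [pow_succ]
    nlinarith
  | succ m hm ih =>
    have hm' : (1 : ℝ) ≤ m := by exact_mod_cast (ha.trans (Nat.le_of_succ_le hm))
    push_cast
    rw [pow_succ 3 m]
    nlinarith

/-- The functional `x ↦ ∑ i ∈ S, x i`. -/
noncomputable def sumOn (S : Finset V) : (V → ℝ) →L[ℝ] ℝ :=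
  ∑ i ∈ S, ContinuousLinearMap.proj i

theorem sumOn_apply (S : Finset V) (x : V → ℝ) : sumOn S x = ∑ i ∈ S, x i := by
  simp [sumOn]

variable [Fintype V]

/-- The nested sets (tubings) of a graph: sets of pairwise compatible proper connected vertex
sets. -/
def nestedSets (Γ : SimpleGraph V) : Set (Finset (Finset V)) :=
  {N | IsNested Γ N ∧ Finset.univ ∉ N}

theorem isLowerSet_nestedSets : IsLowerSet (nestedSets Γ) :=
  fun _ _ h hN => ⟨hN.1.subset h, fun hu => hN.2 (h hu)⟩

open Classical in
/-- A nested set is the set of tight inequalities of a point of the graph-associahedron. -/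
theorem IsNested.exists_point {N : Finset (Finset V)} (hN : IsNested Γ N)
    (huniv : Finset.univ ∈ N) :
    ∃ x : V → ℝ, (∀ S ∈ N, ∑ i ∈ S, x i = 3 ^ S.card) ∧
      ∀ T : Finset V, (Γ.induce (T : Set V)).Connected → T ∉ N → 3 ^ T.card < ∑ i ∈ T, x i := by
  obtain ⟨x, hx⟩ := hN.exists_even_point
  have hU : ∀ S, ∑ i ∈ innerUnion N S, x i ≤ 3 ^ (innerUnion N S).card := fun S =>
    (hN.subset (Finset.filter_subset (· ⊂ S) N)).sum_biUnion_le
      fun R hR => (hx R (Finset.mem_filter.1 hR).1).1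
  -- With `u` and `m` the sizes of the inner union and of its complement in `S`, the inner union
  -- uses at most `3 ^ u` of `3 ^ (u + m)`; the remainder is shared equally by `m` vertices.
  have hy : ∀ S ∈ N, ∀ i ∈ S \ innerUnion N S,
      3 ^ (innerUnion N S).card * (3 ^ (S \ innerUnion N S).card - 1) ≤
        (S \ innerUnion N S).card * x i := by
    intro S hS i hi
    have hsum := (hx S hS).1
    rw [← Finset.sum_sdiff (innerUnion_subset N S),
      Finset.sum_congr rfl fun j hj => (hx S hS).2 j hj i hi, Finset.sum_const, nsmul_eq_mul,
      ← Finset.card_sdiff_add_card_eq_card (innerUnion_subset N S), pow_add] at hsum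
    linarith [hU S]
  have hpos : ∀ i, 0 < x i := by
    intro i
    obtain ⟨S, hS, hmin⟩ := Finset.exists_min_image (N.filter fun S => i ∈ S) Finset.card
      ⟨Finset.univ, by simp [huniv]⟩
    obtain ⟨hS, hiS⟩ := Finset.mem_filter.1 hS
    have hi : i ∈ S \ innerUnion N S := by
      refine Finset.mem_sdiff.2 ⟨hiS, fun h => ?_⟩
      obtain ⟨R, hR, hRS, hiR⟩ := mem_innerUnion.1 h
      exact absurd (hmin R (Finset.mem_filter.2 ⟨hR, hiR⟩)) (not_le.2 (Finset.card_lt_card hRS))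
    have hc := hN.card_sdiff_innerUnion_pos hS
    have h1 : (1 : ℝ) < 3 ^ (S \ innerUnion N S).card := one_lt_pow₀ (by norm_num) hc.ne'
    have h2 : (0 : ℝ) < 3 ^ (innerUnion N S).card * (3 ^ (S \ innerUnion N S).card - 1) :=
      mul_pos (by positivity) (by linarith)
    exact pos_of_mul_pos_right (h2.trans_le (hy S hS i hi)) (Nat.cast_nonneg _)
  refine ⟨x, fun S hS => (hx S hS).1, fun T hT hTN => ?_⟩
  -- In the smallest member `S` containing `T`, the set `T` must use a vertex outside the inner
  -- union of `S`. By positivity these vertices alone bound the sum over `T` from below.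
  obtain ⟨S, hS, hmin⟩ := Finset.exists_min_image (N.filter fun S => T ⊆ S) Finset.card
    ⟨Finset.univ, by simp [huniv]⟩
  obtain ⟨hS, hTS⟩ := Finset.mem_filter.1 hS
  have hTne : T ≠ S := fun h => hTN (h ▸ hS)
  have hcard : T.card < S.card := Finset.card_lt_card (hTS.ssubset_of_ne hTne)
  set U := innerUnion N S
  have hUS : U ⊆ S := innerUnion_subset N S
  have hTU : (T \ U).Nonempty := by
    rw [Finset.sdiff_nonempty]
    intro h
    obtain ⟨R, hR, hRS, hTR⟩ := hN.exists_ssuperset hT h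
    exact absurd (hmin R (Finset.mem_filter.2 ⟨hR, hTR⟩)) (not_le.2 (Finset.card_lt_card hRS))
  obtain ⟨t, ht⟩ := hTU
  have hsub : T \ U ⊆ S \ U := Finset.sdiff_subset_sdiff hTS subset_rfl
  have ha : 1 ≤ (T \ U).card := Finset.card_pos.2 ⟨t, ht⟩
  have ham : (T \ U).card ≤ (S \ U).card := Finset.card_le_card hsub
  have hsumT : ((T \ U).card : ℝ) * x t ≤ ∑ i ∈ T, x i := by
    calc ((T \ U).card : ℝ) * x t = ∑ i ∈ T \ U, x i := by
          rw [Finset.sum_congr rfl fun j hj => (hx S hS).2 j (hsub hj) t (hsub ht),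
            Finset.sum_const, nsmul_eq_mul]
      _ ≤ ∑ i ∈ T, x i := Finset.sum_le_sum_of_subset_of_nonneg Finset.sdiff_subset
          fun i _ _ => (hpos i).le
  refine lt_of_lt_of_le ?_ hsumT
  have hScard : S.card = (S \ U).card + U.card :=
    (Finset.card_sdiff_add_card_eq_card hUS).symm
  have hTcard : T.card ≤ (T \ U).card + U.card := by
    rw [Finset.card_sdiff_add_card]
    exact Finset.card_le_card Finset.subset_union_left
  have hyt := hy S hS t (hsub ht)
  set m := (S \ U).card
  set a := (T \ U).card
  set u := U.card
  have hm0 : (0 : ℝ) < m := by exact_mod_cast ha.trans ham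
  have ha0 : (0 : ℝ) < a := by exact_mod_cast ha
  have hu0 : (0 : ℝ) < 3 ^ u := by positivity
  suffices h : (m : ℝ) * 3 ^ T.card < a * (3 ^ u * (3 ^ m - 1)) by
    have h' := h.trans_le (mul_le_mul_of_nonneg_left hyt ha0.le)
    refine lt_of_mul_lt_mul_left ?_ hm0.le
    linarith
  -- If `T` misses a vertex of `S \ U`, the averaging inequality applies. Otherwise `T` misses a
  -- vertex of `U`, so `T.card < u + m` leaves a spare factor of `3`.
  rcases ham.lt_or_eq with hlt | heq
  · have h1 : (3 : ℝ) ^ T.card ≤ 3 ^ a * 3 ^ u := by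
      rw [← pow_add]
      exact pow_le_pow_right₀ (by norm_num) hTcard
    have h2 := mul_three_pow_lt ha hlt
    nlinarith [mul_le_mul_of_nonneg_left h1 hm0.le, mul_lt_mul_of_pos_left h2 hu0]
  · rw [heq]
    refine mul_lt_mul_of_pos_left ?_ hm0
    have h1 : (3 : ℝ) ^ (T.card + 1) ≤ 3 ^ u * 3 ^ m := by
      rw [← pow_add]
      exact pow_le_pow_right₀ (by norm_num) (by omega)
    have h2 : (3 : ℝ) ^ 1 ≤ 3 ^ m := pow_le_pow_right₀ (by norm_num) (ha.trans ham)
    rw [pow_succ] at h1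
    nlinarith

theorem graphAssociahedronSet_pos {x : V → ℝ} (hx : x ∈ graphAssociahedronSet Γ) (i : V) :
    0 < x i := by
  by_cases hi : ({i} : Finset V) = Finset.univ
  · have := hx.1
    rw [← hi, Finset.sum_singleton] at this
    rw [this]
    positivity
  · have hc : (Γ.induce (({i} : Finset V) : Set V)).Connected := by
      rw [Finset.coe_singleton]
      exact SimpleGraph.Connected.of_subsingleton
    have := hx.2 {i} hi hc
    rw [Finset.sum_singleton] at this
    exact lt_of_lt_of_le (by positivity) this

open Classical in
/-- The proper connected vertex sets of a graph. -/
noncomputable def tubes (Γ : SimpleGraph V) : Finset (Finset V) :=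
  Finset.univ.filter fun S => S ≠ Finset.univ ∧ (Γ.induce (S : Set V)).Connected

theorem mem_tubes {S : Finset V} :
    S ∈ tubes Γ ↔ S ≠ Finset.univ ∧ (Γ.induce (S : Set V)).Connected := by
  simp [tubes]

theorem graphAssociahedronSet_eq (Γ : SimpleGraph V) :
    graphAssociahedronSet Γ = halfspaceInter (sumOn Finset.univ) (3 ^ Fintype.card V) (tubes Γ)
      (fun S => -sumOn S) (fun S => -3 ^ S.card) := by
  ext x
  simp [graphAssociahedronSet, halfspaceInter, mem_tubes, sumOn_apply]

/-- The faces of the graph-associahedron of a connected graph are indexed by its nested sets. -/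
theorem exists_face_orderIso_nestedSets (hΓ : Γ.Connected) :
    ∃ e : Face (graphAssociahedronSet Γ) ≃o (nestedSets Γ)ᵒᵈ, ∀ A,
      dim (graphAssociahedronSet Γ) - dim A.1 = (OrderDual.ofDual (e A)).1.card := by
  classical
  rw [graphAssociahedronSet_eq]
  refine exists_face_orderIso _ isLowerSet_nestedSets ?_ ?_
  · intro x hx
    rw [← graphAssociahedronSet_eq] at hx
    refine ⟨⟨fun S hS => (mem_tubes.1 (mem_tightSet.1 hS).1).2, fun S hS T hT => ?_⟩, fun h =>
      (mem_tubes.1 (mem_tightSet.1 h).1).1 rfl⟩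
    -- For incomparable tight `S`, `T` with connected union, the sums over `S` and `T` add up to
    -- those over `S ∪ T` and `S ∩ T`. The former total at most two thirds of `3 ^ (S ∪ T).card`,
    -- while the sum over `S ∪ T` is at least that power and the one over `S ∩ T` is nonnegative.
    by_contra! hcon
    obtain ⟨h1, h2, h3⟩ := hcon
    have hsum : ∀ R ∈ tightSet (tubes Γ) (fun S => -sumOn S) (fun S => -3 ^ S.card) x,
        ∑ i ∈ R, x i = 3 ^ R.card := fun R hR => by
      simpa [sumOn_apply] using (mem_tightSet.1 hR).2
    have hunion : (3 : ℝ) ^ (S ∪ T).card ≤ ∑ i ∈ S ∪ T, x i := by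
      by_cases hu : S ∪ T = Finset.univ
      · rw [hu, hx.1, Finset.card_univ]
      · exact hx.2 _ hu (by rwa [Finset.coe_union])
    have hinter : 0 ≤ ∑ i ∈ S ∩ T, x i :=
      Finset.sum_nonneg fun i _ => (graphAssociahedronSet_pos hx i).le
    have hadd := Finset.sum_union_inter (s₁ := S) (s₂ := T) (f := x)
    rw [hsum S hS, hsum T hT] at hadd
    have hS1 : S.card + 1 ≤ (S ∪ T).card := Finset.card_lt_card
      ⟨Finset.subset_union_left, fun h => h2 (Finset.subset_union_right.trans h)⟩
    have hT1 : T.card + 1 ≤ (S ∪ T).card := Finset.card_lt_card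
      ⟨Finset.subset_union_right, fun h => h1 (Finset.subset_union_left.trans h)⟩
    have hS2 : (3 : ℝ) ^ (S.card + 1) ≤ 3 ^ (S ∪ T).card := pow_le_pow_right₀ (by norm_num) hS1
    have hT2 : (3 : ℝ) ^ (T.card + 1) ≤ 3 ^ (S ∪ T).card := pow_le_pow_right₀ (by norm_num) hT1
    have hS3 : (0 : ℝ) < 3 ^ S.card := by positivity
    have hT3 : (0 : ℝ) < 3 ^ T.card := by positivity
    rw [pow_succ] at hS2 hT2
    linarith
  · intro N hN
    have hconn : (Γ.induce ((Finset.univ : Finset V) : Set V)).Connected := by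
      rw [Finset.coe_univ]
      exact (SimpleGraph.induceUnivIso Γ).connected_iff.2 hΓ
    have hN' : IsNested Γ (insert Finset.univ N) := by
      refine ⟨fun S hS => ?_, fun S hS T hT => ?_⟩
      · rcases Finset.mem_insert.1 hS with rfl | hS
        · exact hconn
        · exact hN.1.1 S hS
      · rcases Finset.mem_insert.1 hS with rfl | hS
        · exact Or.inr (Or.inl (Finset.subset_univ _))
        · rcases Finset.mem_insert.1 hT with rfl | hT
          · exact Or.inl (Finset.subset_univ _)
          · exact hN.1.2 S hS T hT
    obtain ⟨x, hx, hx'⟩ := hN'.exists_point (Finset.mem_insert_self _ _)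
    refine ⟨x, ?_, ?_⟩
    · rw [← graphAssociahedronSet_eq]
      refine ⟨by rw [hx _ (Finset.mem_insert_self _ _), Finset.card_univ], fun S hS hSc => ?_⟩
      by_cases hSN : S ∈ insert Finset.univ N
      · exact (hx S hSN).ge
      · exact (hx' S hSc hSN).le
    · ext S
      rw [mem_tightSet, mem_tubes]
      simp only [_root_.neg_apply, sumOn_apply, neg_inj]
      constructor
      · rintro ⟨⟨hS, hSc⟩, h⟩
        by_contra hSN
        exact (hx' S hSc (by simp [hS, hSN])).ne' h
      · intro h
        exact ⟨⟨fun hu => hN.2 (hu ▸ h), hN.1.1 S h⟩, hx S (Finset.mem_insert_of_mem h)⟩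

end NestedSets

end PolytopeRing

namespace PolytopeRing

/-! ### Ring elements attached to dual face posets. -/

section PosetClass

/-- The poset `X` is the opposite of the face poset of a polytope of class `c`. -/
def IsRealizedBy (c : CombPolytope) (X : Type) [LE X] : Prop :=
  ∃ P : Σ n, Polytope n, P.2.toComb = c ∧ Nonempty (Face P.2.carrier ≃o Xᵒᵈ)

/-- The poset `X` is the opposite of the face poset of some polytope. -/
def IsRealizable (X : Type) [LE X] : Prop :=
  ∃ c, IsRealizedBy c X

open Classical in
/-- The element of the ring of polytopes given by a polytope whose face poset is opposite to `X`
(zero if there is none). -/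
noncomputable def posetClass (X : Type) [LE X] : PRing :=
  if h : IsRealizable X then MonoidAlgebra.of ℤ CombPolytope h.choose else 0

section

variable {X Y : Type} [Preorder X] [Preorder Y] {c d : CombPolytope}

theorem IsRealizedBy.congr (h : IsRealizedBy c X) (e : X ≃o Y) : IsRealizedBy c Y := by
  obtain ⟨P, hP, ⟨f⟩⟩ := h
  exact ⟨P, hP, ⟨f.trans e.dual⟩⟩

theorem IsRealizedBy.unique (h : IsRealizedBy c X) (h' : IsRealizedBy d X) : c = d := by
  obtain ⟨P, rfl, ⟨f⟩⟩ := h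
  obtain ⟨Q, rfl, ⟨g⟩⟩ := h'
  exact Quotient.sound ⟨f.trans g.symm⟩

theorem IsRealizedBy.prod (h : IsRealizedBy c X) (h' : IsRealizedBy d Y) :
    IsRealizedBy (c * d) (X × Y) := by
  obtain ⟨P, rfl, ⟨f⟩⟩ := h
  obtain ⟨Q, rfl, ⟨g⟩⟩ := h'
  obtain ⟨a⟩ := P.2.face_prod Q.2
  exact ⟨⟨P.1 + Q.1, P.2.prod Q.2⟩, rfl,
    ⟨a.trans ((prodOrderIso f g).trans ⟨Equiv.refl _, Iff.rfl⟩)⟩⟩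

theorem isRealizedBy_one [Unique X] : IsRealizedBy 1 X := by
  obtain ⟨e⟩ := Polytope.face_point
  refine ⟨⟨0, Polytope.point⟩, rfl, ⟨e.trans ⟨⟨fun _ => OrderDual.toDual default, fun _ => (),
    fun _ => rfl, fun x => Subsingleton.elim (α := X) _ _⟩, by simp⟩⟩⟩

theorem posetClass_eq (h : IsRealizedBy c X) :
    posetClass X = MonoidAlgebra.of ℤ CombPolytope c := by
  have h' : IsRealizable X := ⟨c, h⟩
  rw [posetClass, dif_pos h', h'.choose_spec.unique h]

theorem posetClass_congr (e : X ≃o Y) : posetClass X = posetClass Y := by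
  by_cases h : IsRealizable X
  · obtain ⟨c, hc⟩ := h
    rw [posetClass_eq hc, posetClass_eq (hc.congr e)]
  · have h' : ¬ IsRealizable Y := fun ⟨c, hc⟩ => h ⟨c, hc.congr e.symm⟩
    rw [posetClass, posetClass, dif_neg h, dif_neg h']

theorem posetClass_prod (hX : IsRealizable X) (hY : IsRealizable Y) :
    posetClass (X × Y) = posetClass X * posetClass Y := by
  obtain ⟨c, hc⟩ := hX
  obtain ⟨d, hd⟩ := hY
  rw [posetClass_eq hc, posetClass_eq hd, posetClass_eq (hc.prod hd), map_mul]

theorem posetClass_unique [Unique X] : posetClass X = 1 := by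
  rw [posetClass_eq isRealizedBy_one, map_one]

theorem Polytope.isRealizedBy {n : ℕ} (P : Polytope n) (e : Face P.carrier ≃o Xᵒᵈ) :
    IsRealizedBy P.toComb X :=
  ⟨⟨n, P⟩, rfl, ⟨e⟩⟩

theorem Polytope.toRing_eq {n : ℕ} (P : Polytope n) (e : Face P.carrier ≃o Xᵒᵈ) :
    P.toRing = posetClass X :=
  (posetClass_eq (P.isRealizedBy e)).symm

/-- The faces of `A` are the faces of `P` below `A`, which the order-reversing index turns into the
elements above that of `A`. -/
theorem Polytope.face_isRealizedBy {n : ℕ} (P : Polytope n) (e : Face P.carrier ≃o Xᵒᵈ)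
    (A : Face P.carrier) :
    IsRealizedBy (P.face A).toComb (Set.Ici (OrderDual.ofDual (e A))) := by
  obtain ⟨f⟩ := P.isPolytope.face_face A
  refine (P.face A).isRealizedBy (f.trans ?_)
  exact
    { toFun := fun B => OrderDual.toDual ⟨OrderDual.ofDual (e B.1), e.monotone B.2⟩
      invFun := fun x => ⟨e.symm (OrderDual.toDual (OrderDual.ofDual x).1), by
        have h : OrderDual.toDual (OrderDual.ofDual x).1 ≤ e A := (OrderDual.ofDual x).2
        exact (e.symm_apply_le (x := A)).2 h⟩
      left_inv := fun B => Subtype.ext (e.symm_apply_apply _)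
      right_inv := fun x => congrArg OrderDual.toDual (Subtype.ext
        (congrArg OrderDual.ofDual (e.apply_symm_apply _)))
      map_rel_iff' := fun {B C} => e.le_iff_le (x := B.1) (y := C.1) }

theorem IsRealizable.congr (h : IsRealizable X) (e : X ≃o Y) : IsRealizable Y :=
  h.imp fun _ hc => hc.congr e

theorem IsRealizable.Ici (h : IsRealizable X) (x : X) : IsRealizable (Set.Ici x) := by
  obtain ⟨c, P, -, ⟨e⟩⟩ := h
  have := P.2.face_isRealizedBy e (e.symm (OrderDual.toDual x))
  rw [e.apply_symm_apply] at this
  exact ⟨_, this⟩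

/-- An order isomorphism restricts to the elements above a given one. -/
def orderIsoIci (e : X ≃o Y) (x : X) : Set.Ici x ≃o Set.Ici (e x) where
  toFun z := ⟨e z.1, e.monotone z.2⟩
  invFun z := ⟨e.symm z.1, (e.le_symm_apply (y := z.1)).2 z.2⟩
  left_inv _ := Subtype.ext (e.symm_apply_apply _)
  right_inv _ := Subtype.ext (e.apply_symm_apply _)
  map_rel_iff' := fun {z w} => e.le_iff_le (x := z.1) (y := w.1)

open Polynomial in
theorem Polytope.eval_facePolynomial {n : ℕ} (P : Polytope n) [Fintype X]
    (e : Face P.carrier ≃o Xᵒᵈ) (r : X → ℕ)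
    (hr : ∀ A : Face P.carrier, dim P.carrier - dim A.1 = r (OrderDual.ofDual (e A))) :
    P.facePolynomial.eval (-1) = ∑ x, (-1) ^ r x * posetClass (Set.Ici x) := by
  rw [facePolynomial, eval_finsetSum]
  refine Fintype.sum_equiv (e.toEquiv.trans OrderDual.ofDual) _ _ fun A => ?_
  rw [eval_mul, eval_C, eval_pow, eval_X, hr, mul_comm]
  congr 1
  exact (posetClass_eq (P.face_isRealizedBy e A)).symm

end

end PosetClass

end PolytopeRing

namespace PolytopeRing

/-! ### Chains and pointed chains in a finite poset. -/

section Chains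

variable {α β : Type} [PartialOrder α] [PartialOrder β]

/-- The chains of the interval `[a, b]` that contain both endpoints. -/
abbrev IntervalChain (a b : α) : Type :=
  {C : Finset α // a ∈ C ∧ b ∈ C ∧ IsChain (· ≤ ·) (C : Set α) ∧ ∀ x ∈ C, a ≤ x ∧ x ≤ b}

/-- The pairs of an element `x ≥ a` and a chain in the interval `[x, b]` that contains `b`. -/
abbrev PointedChain (a b : α) : Type :=
  {p : α × Finset α // a ≤ p.1 ∧ b ∈ p.2 ∧ IsChain (· ≤ ·) (p.2 : Set α) ∧
    ∀ x ∈ p.2, p.1 ≤ x ∧ x ≤ b}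

noncomputable instance [Finite α] (a b : α) : Fintype (IntervalChain a b) :=
  Fintype.ofFinite _

noncomputable instance [Finite α] (a b : α) : Fintype (PointedChain a b) :=
  Fintype.ofFinite _

theorem IntervalChain.left_le {a b : α} (C : IntervalChain a b) : a ≤ b :=
  (C.2.2.2.2 a C.2.1).2

open Classical in
theorem isChain_union_of_le {s t : Finset α} {m : α} (hs : IsChain (· ≤ ·) (s : Set α))
    (ht : IsChain (· ≤ ·) (t : Set α)) (hsm : ∀ x ∈ s, x ≤ m) (hmt : ∀ x ∈ t, m ≤ x) :
    IsChain (· ≤ ·) ((s ∪ t : Finset α) : Set α) := by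
  rw [Finset.coe_union, isChain_union]
  exact ⟨hs, ht, fun x hx y hy _ => Or.inl ((hsm x hx).trans (hmt y hy))⟩

open Classical in
theorem filter_le_union {s t : Finset α} {m : α} (hms : m ∈ s) (hs : ∀ x ∈ s, x ≤ m)
    (ht : ∀ x ∈ t, m ≤ x) : (s ∪ t).filter (· ≤ m) = s := by
  ext x
  simp only [Finset.mem_filter, Finset.mem_union]
  exact ⟨fun ⟨h, hx⟩ => h.elim id fun h => (hx.antisymm (ht x h)) ▸ hms, fun h => ⟨Or.inl h, hs x h⟩⟩

open Classical in
theorem filter_ge_union {s t : Finset α} {m : α} (hmt : m ∈ t) (hs : ∀ x ∈ s, x ≤ m)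
    (ht : ∀ x ∈ t, m ≤ x) : (s ∪ t).filter (m ≤ ·) = t := by
  rw [Finset.union_comm]
  exact filter_le_union (α := αᵒᵈ) hmt ht hs

open Classical in
theorem filter_union_filter_of_isChain {s : Finset α} {m : α} (hs : IsChain (· ≤ ·) (s : Set α))
    (hm : m ∈ s) : s.filter (· ≤ m) ∪ s.filter (m ≤ ·) = s := by
  rw [← Finset.filter_or, Finset.filter_true_of_mem]
  exact fun x hx => hs.total hx hm

open Classical in
/-- Adjoin a new least element to a chain. -/
noncomputable def IntervalChain.cons {a m b : α} (h : a ≤ m) (D : IntervalChain m b) :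
    IntervalChain a b :=
  ⟨insert a D.1, Finset.mem_insert_self _ _, Finset.mem_insert_of_mem D.2.2.1, by
    have := isChain_union_of_le (s := {a}) (t := D.1) (m := m) (by simp) D.2.2.2.1 (by simpa using h)
      fun x hx => (D.2.2.2.2 x hx).1
    rwa [← Finset.insert_eq] at this, by
    intro x hx
    rcases Finset.mem_insert.1 hx with rfl | hx
    · exact ⟨le_rfl, h.trans D.left_le⟩
    · exact ⟨h.trans (D.2.2.2.2 x hx).1, (D.2.2.2.2 x hx).2⟩⟩

open Classical in
/-- The chains refining `{a} ∪ D`, where `m` is the least element of `D`, are pairs of a chain from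
`a` to `m` and a refinement of `D`. -/
noncomputable def IntervalChain.iciConsIso {a m b : α} (h : a ≤ m) (D : IntervalChain m b) :
    Set.Ici (D.cons h) ≃o IntervalChain a m × Set.Ici D := by
  -- Every refinement contains `m`, so it is the union of its parts below and above `m`, each of
  -- which contains `m`.
  have hD : ∀ C : Set.Ici (D.cons h), D.1 ⊆ C.1.1 := fun C x hx =>
    C.2 (Finset.mem_insert_of_mem hx)
  refine Equiv.toOrderIso
    { toFun := fun C => (⟨C.1.1.filter (· ≤ m), ?_⟩, ⟨⟨C.1.1.filter (m ≤ ·), ?_⟩, ?_⟩)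
      invFun := fun p => ⟨⟨p.1.1 ∪ p.2.1.1, ?_⟩, ?_⟩
      left_inv := ?_
      right_inv := ?_ } ?_ ?_
  · refine ⟨Finset.mem_filter.2 ⟨C.1.2.1, h⟩, Finset.mem_filter.2 ⟨hD C D.2.1, le_rfl⟩,
      C.1.2.2.2.1.mono (Finset.coe_subset.2 (Finset.filter_subset _ _)), fun x hx => ?_⟩
    obtain ⟨hx, hxm⟩ := Finset.mem_filter.1 hx
    exact ⟨(C.1.2.2.2.2 x hx).1, hxm⟩
  · refine ⟨Finset.mem_filter.2 ⟨hD C D.2.1, le_rfl⟩, Finset.mem_filter.2 ⟨C.1.2.2.1, D.left_le⟩,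
      C.1.2.2.2.1.mono (Finset.coe_subset.2 (Finset.filter_subset _ _)), fun x hx => ?_⟩
    obtain ⟨hx, hxm⟩ := Finset.mem_filter.1 hx
    exact ⟨hxm, (C.1.2.2.2.2 x hx).2⟩
  · exact fun x hx => Finset.mem_filter.2 ⟨hD C hx, (D.2.2.2.2 x hx).1⟩
  · refine ⟨Finset.mem_union_left _ p.1.2.1, Finset.mem_union_right _ p.2.1.2.2.1,
      isChain_union_of_le p.1.2.2.2.1 p.2.1.2.2.2.1 (fun x hx => (p.1.2.2.2.2 x hx).2)
        (fun x hx => (p.2.1.2.2.2.2 x hx).1), fun x hx => ?_⟩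
    rcases Finset.mem_union.1 hx with hx | hx
    · exact ⟨(p.1.2.2.2.2 x hx).1, (p.1.2.2.2.2 x hx).2.trans D.left_le⟩
    · exact ⟨h.trans (p.2.1.2.2.2.2 x hx).1, (p.2.1.2.2.2.2 x hx).2⟩
  · exact Finset.insert_subset (Finset.mem_union_left _ p.1.2.1)
      (Finset.Subset.trans p.2.2 Finset.subset_union_right)
  · exact fun C => Subtype.ext (Subtype.ext
      (filter_union_filter_of_isChain C.1.2.2.2.1 (hD C D.2.1)))
  · intro p
    exact Prod.ext
      (Subtype.ext (filter_le_union p.1.2.2.1 (fun x hx => (p.1.2.2.2.2 x hx).2)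
        (fun x hx => (p.2.1.2.2.2.2 x hx).1)))
      (Subtype.ext (Subtype.ext (filter_ge_union p.2.1.2.1 (fun x hx => (p.1.2.2.2.2 x hx).2)
        (fun x hx => (p.2.1.2.2.2.2 x hx).1))))
  · exact fun C C' hC => ⟨Finset.filter_subset_filter _ hC, Finset.filter_subset_filter _ hC⟩
  · exact fun p q hpq => Finset.union_subset_union hpq.1 hpq.2

/-- The pair of a point and a chain above it. -/
def PointedChain.ofChain {a x m b : α} (hx : a ≤ x) (hxm : x ≤ m) (D : IntervalChain m b) :
    PointedChain a b :=
  ⟨(x, D.1), hx, D.2.2.1, D.2.2.2.1, fun y hy =>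
    ⟨hxm.trans (D.2.2.2.2 y hy).1, (D.2.2.2.2 y hy).2⟩⟩

open Classical in
/-- The pairs refining `(x, D)`, where `m` is the least element of `D`, consist of a pair below `m`
and a refinement of `D`. -/
noncomputable def PointedChain.iciOfChainIso {a x m b : α} (hx : a ≤ x) (hxm : x ≤ m)
    (D : IntervalChain m b) :
    Set.Ici (ofChain hx hxm D) ≃o PointedChain x m × Set.Ici D := by
  have hD : ∀ C : Set.Ici (ofChain hx hxm D), D.1 ⊆ C.1.1.2 := fun C => C.2.2
  refine Equiv.toOrderIso
    { toFun := fun C => (⟨(C.1.1.1, C.1.1.2.filter (· ≤ m)), ?_⟩,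
        ⟨⟨C.1.1.2.filter (m ≤ ·), ?_⟩, ?_⟩)
      invFun := fun p => ⟨⟨(p.1.1.1, p.1.1.2 ∪ p.2.1.1), ?_⟩, ?_⟩
      left_inv := ?_
      right_inv := ?_ } ?_ ?_
  · refine ⟨C.2.1, Finset.mem_filter.2 ⟨hD C D.2.1, le_rfl⟩,
      C.1.2.2.2.1.mono (Finset.coe_subset.2 (Finset.filter_subset _ _)), fun x hx => ?_⟩
    obtain ⟨hx, hxm⟩ := Finset.mem_filter.1 hx
    exact ⟨(C.1.2.2.2.2 x hx).1, hxm⟩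
  · refine ⟨Finset.mem_filter.2 ⟨hD C D.2.1, le_rfl⟩, Finset.mem_filter.2 ⟨C.1.2.2.1, D.left_le⟩,
      C.1.2.2.2.1.mono (Finset.coe_subset.2 (Finset.filter_subset _ _)), fun x hx => ?_⟩
    obtain ⟨hx, hxm⟩ := Finset.mem_filter.1 hx
    exact ⟨hxm, (C.1.2.2.2.2 x hx).2⟩
  · exact fun x hx => Finset.mem_filter.2 ⟨hD C hx, (D.2.2.2.2 x hx).1⟩
  · refine ⟨hx.trans p.1.2.1, Finset.mem_union_right _ p.2.1.2.2.1,
      isChain_union_of_le p.1.2.2.2.1 p.2.1.2.2.2.1 (fun x hx => (p.1.2.2.2.2 x hx).2)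
        (fun x hx => (p.2.1.2.2.2.2 x hx).1), fun y hy => ?_⟩
    rcases Finset.mem_union.1 hy with hy | hy
    · exact ⟨(p.1.2.2.2.2 y hy).1, (p.1.2.2.2.2 y hy).2.trans D.left_le⟩
    · exact ⟨(p.1.2.2.2.2 m p.1.2.2.1).1.trans (p.2.1.2.2.2.2 y hy).1, (p.2.1.2.2.2.2 y hy).2⟩
  · exact ⟨p.1.2.1, Finset.Subset.trans p.2.2 Finset.subset_union_right⟩
  · exact fun C => Subtype.ext (Subtype.ext (Prod.ext rfl
      (filter_union_filter_of_isChain C.1.2.2.2.1 (hD C D.2.1))))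
  · intro p
    exact Prod.ext
      (Subtype.ext (Prod.ext rfl (filter_le_union p.1.2.2.1 (fun x hx => (p.1.2.2.2.2 x hx).2)
        (fun x hx => (p.2.1.2.2.2.2 x hx).1))))
      (Subtype.ext (Subtype.ext (filter_ge_union p.2.1.2.1 (fun x hx => (p.1.2.2.2.2 x hx).2)
        (fun x hx => (p.2.1.2.2.2.2 x hx).1))))
  · exact fun C C' hC => ⟨⟨hC.1, Finset.filter_subset_filter _ hC.2⟩,
      Finset.filter_subset_filter _ hC.2⟩
  · exact fun p q hpq => ⟨hpq.1.1, Finset.union_subset_union hpq.1.2 hpq.2⟩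

theorem isChain_map (g : α ↪o β) {C : Finset α} :
    IsChain (· ≤ ·) ((C.map g.toEmbedding : Finset β) : Set β) ↔
      IsChain (· ≤ ·) (C : Set α) := by
  rw [Finset.coe_map]
  constructor
  · intro h x hx y hy hxy
    have := h (Set.mem_image_of_mem _ hx) (Set.mem_image_of_mem _ hy)
      (g.injective.ne hxy)
    simpa using this
  · rintro h _ ⟨x, hx, rfl⟩ _ ⟨y, hy, rfl⟩ hxy
    have := h hx hy fun h => hxy (h ▸ rfl)
    simpa using this

theorem exists_map_eq (g : α ↪o β) {a b : α}
    (hg : ∀ y, g a ≤ y → y ≤ g b → ∃ x, g x = y) {C : Finset β}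
    (hC : ∀ y ∈ C, g a ≤ y ∧ y ≤ g b) : ∃ D : Finset α, D.map g.toEmbedding = C := by
  refine ⟨C.preimage g g.injective.injOn, ?_⟩
  ext y
  simp only [Finset.mem_map, Finset.mem_preimage]
  constructor
  · rintro ⟨x, hx, rfl⟩
    exact hx
  · intro hy
    obtain ⟨x, rfl⟩ := hg y (hC y hy).1 (hC y hy).2
    exact ⟨x, hy, rfl⟩

/-- An order embedding onto an interval induces an isomorphism of posets of chains. -/
theorem IntervalChain.exists_mapIso (g : α ↪o β) (a b : α)
    (hg : ∀ y, g a ≤ y → y ≤ g b → ∃ x, g x = y) :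
    ∃ e : IntervalChain a b ≃o IntervalChain (g a) (g b), ∀ C, (e C).1.card = C.1.card := by
  let f : IntervalChain a b ↪o IntervalChain (g a) (g b) :=
    OrderEmbedding.ofMapLEIff
      (fun C => ⟨C.1.map g.toEmbedding, Finset.mem_map_of_mem _ C.2.1,
        Finset.mem_map_of_mem _ C.2.2.1, (isChain_map g).2 C.2.2.2.1, by
          simpa using C.2.2.2.2⟩)
      (fun C D => Finset.map_subset_map)
  refine ⟨RelIso.ofSurjective f ?_, fun C => Finset.card_map _⟩
  rintro ⟨C, ha, hb, hch, hC⟩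
  obtain ⟨D, rfl⟩ := exists_map_eq g hg hC
  exact ⟨⟨D, by simpa using ha, by simpa using hb, (isChain_map g).1 hch, by simpa using hC⟩, rfl⟩

/-- An order embedding onto an interval induces an isomorphism of posets of pointed chains. -/
theorem PointedChain.nonempty_mapIso (g : α ↪o β) (a b : α)
    (hg : ∀ y, g a ≤ y → y ≤ g b → ∃ x, g x = y) :
    Nonempty (PointedChain a b ≃o PointedChain (g a) (g b)) := by
  let f : PointedChain a b ↪o PointedChain (g a) (g b) :=
    OrderEmbedding.ofMapLEIff
      (fun C => ⟨(g C.1.1, C.1.2.map g.toEmbedding), g.monotone C.2.1,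
        Finset.mem_map_of_mem _ C.2.2.1, (isChain_map g).2 C.2.2.2.1, by
          simpa using C.2.2.2.2⟩)
      (fun C D => and_congr g.le_iff_le Finset.map_subset_map)
  refine ⟨RelIso.ofSurjective f ?_⟩
  rintro ⟨⟨x, C⟩, ha, hb, hch, hC⟩
  obtain ⟨x, rfl⟩ := hg x ha (hC _ hb).1
  obtain ⟨D, rfl⟩ := exists_map_eq g hg fun y hy => ⟨ha.trans (hC y hy).1, (hC y hy).2⟩
  exact ⟨⟨(x, D), by simpa using ha, by simpa using hb, (isChain_map g).1 hch,
    by simpa using hC⟩, rfl⟩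

theorem exists_least_of_isChain {C : Finset α} (hC : IsChain (· ≤ ·) (C : Set α))
    (hne : C.Nonempty) : ∃ m ∈ C, ∀ x ∈ C, m ≤ x := by
  obtain ⟨m, hm⟩ := C.exists_minimal hne
  exact ⟨m, hm.1, fun x hx => (hC.total hm.1 hx).elim id fun h => hm.2 hx h⟩

/-- The signed sum, over the chains from `a` to `b`, of the classes of the posets of their
refinements. -/
noncomputable def chainSum [Finite α] (a b : α) : PRing :=
  -- The shift by one gives the one-element chain, present when `a = b`, the sign `+1`.
  ∑ D : IntervalChain a b, (-1) ^ (D.1.card + 1) * posetClass (Set.Ici D)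

theorem chainSum_map [Finite α] [Finite β] (g : α ↪o β) (a b : α)
    (hg : ∀ y, g a ≤ y → y ≤ g b → ∃ x, g x = y) : chainSum a b = chainSum (g a) (g b) := by
  obtain ⟨e, he⟩ := IntervalChain.exists_mapIso g a b hg
  refine Fintype.sum_equiv e.toEquiv _ _ fun C => ?_
  change _ = (-1) ^ ((e C).1.card + 1) * posetClass (Set.Ici (e C))
  rw [he, posetClass_congr (orderIsoIci e C)]

open Classical in
/-- The chains from `a` to `b` sorted by their second smallest element. -/
theorem bijective_cons {a b : α} (hab : a < b) :
    Function.Bijective fun p : Σ m : {m // a < m ∧ m ≤ b}, IntervalChain m.1 b =>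
      p.2.cons p.1.2.1.le := by
  have hnot : ∀ (m : {m // a < m ∧ m ≤ b}) (D : IntervalChain m.1 b), a ∉ D.1 := fun m D h =>
    absurd (D.2.2.2.2 a h).1 (not_le_of_gt m.2.1)
  constructor
  · rintro ⟨m, D⟩ ⟨m', D'⟩ h
    have h1 : insert a D.1 = insert a D'.1 := congrArg Subtype.val h
    have h2 : D.1 = D'.1 := by
      rw [← Finset.erase_insert (hnot m D), h1, Finset.erase_insert (hnot m' D')]
    obtain rfl : m = m' := Subtype.ext (le_antisymm
      (D.2.2.2.2 m'.1 (h2 ▸ D'.2.1)).1 (D'.2.2.2.2 m.1 (h2 ▸ D.2.1)).1)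
    obtain rfl : D = D' := Subtype.ext h2
    rfl
  · intro C
    have hch : IsChain (· ≤ ·) ((C.1.erase a : Finset α) : Set α) :=
      C.2.2.2.1.mono (Finset.coe_subset.2 (Finset.erase_subset a C.1))
    have hb : b ∈ C.1.erase a := Finset.mem_erase.2 ⟨hab.ne', C.2.2.1⟩
    obtain ⟨m, hm, hmin⟩ := exists_least_of_isChain hch ⟨b, hb⟩
    have hm' := Finset.mem_erase.1 hm
    refine ⟨⟨⟨m, lt_of_le_of_ne (C.2.2.2.2 m hm'.2).1 hm'.1.symm, hmin b hb⟩,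
      ⟨C.1.erase a, hm, hb, hch, fun x hx =>
        ⟨hmin x hx, (C.2.2.2.2 x (Finset.mem_of_mem_erase hx)).2⟩⟩⟩, ?_⟩
    exact Subtype.ext (Finset.insert_erase C.2.1)

/-- The pointed chains sorted by the least element of the chain. -/
theorem bijective_ofChain (a b : α) :
    Function.Bijective fun p : Σ m : {m // a ≤ m ∧ m ≤ b},
        {x // a ≤ x ∧ x ≤ m.1} × IntervalChain m.1 b =>
      PointedChain.ofChain p.2.1.2.1 p.2.1.2.2 p.2.2 := by
  constructor
  · rintro ⟨m, x, D⟩ ⟨m', x', D'⟩ h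
    have h0 : (x.1, D.1) = (x'.1, D'.1) := congrArg Subtype.val h
    have h1 : x.1 = x'.1 := congrArg Prod.fst h0
    have h2 : D.1 = D'.1 := congrArg Prod.snd h0
    obtain rfl : m = m' := Subtype.ext (le_antisymm
      (D.2.2.2.2 m'.1 (h2 ▸ D'.2.1)).1 (D'.2.2.2.2 m.1 (h2 ▸ D.2.1)).1)
    obtain rfl : D = D' := Subtype.ext h2
    obtain rfl : x = x' := Subtype.ext h1
    rfl
  · rintro ⟨⟨x, C⟩, hax, hb, hch, hC⟩
    obtain ⟨m, hm, hmin⟩ := exists_least_of_isChain hch ⟨b, hb⟩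
    exact ⟨⟨⟨m, hax.trans (hC m hm).1, (hC m hm).2⟩, ⟨x, hax, (hC m hm).1⟩,
      ⟨C, hm, hb, hch, fun y hy => ⟨hmin y hy, (hC y hy).2⟩⟩⟩, rfl⟩

-- Deleting `a` from a chain leaves a chain starting at its second smallest element `m`. The sign
-- flips, and the poset of refinements loses the factor of chains from `a` to `m`. This is the
-- recursion for a convolution inverse.
open Classical in
theorem chainSum_eq_neg_sum [Fintype α] {a b : α} (hab : a < b)
    (hreal : ∀ x y : α, x ≤ y → IsRealizable (IntervalChain x y)) :
    chainSum a b = -∑ m with a < m ∧ m ≤ b, posetClass (IntervalChain a m) * chainSum m b := by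
  rw [chainSum, ← (Equiv.ofBijective _ (bijective_cons hab)).sum_comp, Fintype.sum_sigma,
    ← Finset.sum_neg_distrib, Finset.sum_subtype (p := fun m => a < m ∧ m ≤ b) _ (by simp)]
  refine Finset.sum_congr rfl fun m _ => ?_
  rw [chainSum, Finset.mul_sum, ← Finset.sum_neg_distrib]
  refine Finset.sum_congr rfl fun D _ => ?_
  have hcard : (D.cons m.2.1.le).1.card = D.1.card + 1 :=
    Finset.card_insert_of_notMem fun h => absurd (D.2.2.2.2 a h).1 (not_le_of_gt m.2.1)
  rw [Equiv.ofBijective_apply, hcard, posetClass_congr (D.iciConsIso m.2.1.le),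
    posetClass_prod (hreal _ _ m.2.1.le) ((hreal _ _ m.2.2).Ici D), pow_succ]
  ring

-- For a pair `(x, D)` with `m` the least element of `D`, the refinements are pairs below `m` times
-- refinements of `D`. For fixed `m`, the sums over `x` and `D` are therefore independent.
open Classical in
theorem sum_pointedChain [Fintype α] (a b : α) (w : α → ℕ)
    (hT : ∀ x y : α, x ≤ y → IsRealizable (IntervalChain x y))
    (hS : ∀ x y : α, x ≤ y → IsRealizable (PointedChain x y)) :
    ∑ p : PointedChain a b, (-1) ^ (w p.1.1 + p.1.2.card + 1) * posetClass (Set.Ici p) =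
      ∑ m with a ≤ m ∧ m ≤ b,
        (∑ x with a ≤ x ∧ x ≤ m, (-1) ^ w x * posetClass (PointedChain x m)) * chainSum m b := by
  rw [← (Equiv.ofBijective _ (bijective_ofChain a b)).sum_comp, Fintype.sum_sigma,
    Finset.sum_subtype (p := fun m => a ≤ m ∧ m ≤ b) _ (by simp)]
  refine Finset.sum_congr rfl fun m _ => ?_
  rw [chainSum, Finset.sum_subtype (p := fun x => a ≤ x ∧ x ≤ m.1) _ (by simp),
    Finset.sum_mul_sum, Fintype.sum_prod_type]
  refine Finset.sum_congr rfl fun x _ => Finset.sum_congr rfl fun D _ => ?_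
  rw [Equiv.ofBijective_apply,
    posetClass_congr (PointedChain.iciOfChainIso x.2.1 x.2.2 D),
    posetClass_prod (hS _ _ x.2.2) ((hT _ _ m.2.2).Ici D)]
  change (-1) ^ (w x.1 + D.1.card + 1) * _ = _
  rw [add_assoc, pow_add]
  ring

end Chains

end PolytopeRing

namespace PolytopeRing

/-! ### Intervals in Boolean lattices. -/

section FinsetChains

/-- An interval of finite sets is a lattice of subsets. -/
theorem exists_orderEmbedding_interval {ι : Type} [DecidableEq ι] {A B : Finset ι} (h : A ⊆ B) :
    ∃ g : Finset (Fin (B.card - A.card)) ↪o Finset ι, g ∅ = A ∧ g Finset.univ = B ∧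
      (∀ y, A ≤ y → y ≤ B → ∃ x, g x = y) := by
  have hc : (B \ A).card = B.card - A.card := Finset.card_sdiff_of_subset h
  let e : Fin (B.card - A.card) ↪ ι :=
    ((B \ A).equivFinOfCardEq hc).symm.toEmbedding.trans (Function.Embedding.subtype _)
  have he : ∀ i, e i ∈ B \ A := fun i => (((B \ A).equivFinOfCardEq hc).symm i).2
  have hes : ∀ y ∈ B \ A, ∃ i, e i = y := fun y hy =>
    ⟨(B \ A).equivFinOfCardEq hc ⟨y, hy⟩, by simp [e]⟩
  have hdisj : ∀ S : Finset (Fin (B.card - A.card)), ∀ x ∈ S.map e, x ∉ A := by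
    intro S x hx
    obtain ⟨i, -, rfl⟩ := Finset.mem_map.1 hx
    exact (Finset.mem_sdiff.1 (he i)).2
  refine ⟨OrderEmbedding.ofMapLEIff (fun S => A ∪ S.map e) fun S T => ⟨fun hST => ?_, fun hST =>
    Finset.union_subset_union subset_rfl (Finset.map_subset_map.2 hST)⟩, by simp, ?_, ?_⟩
  · refine Finset.map_subset_map (f := e).1 fun x hx => ?_
    exact (Finset.mem_union.1 (hST (Finset.mem_union_right _ hx))).resolve_left (hdisj S x hx)
  · ext x
    simp only [OrderEmbedding.coe_ofMapLEIff, Finset.mem_union, Finset.mem_map, Finset.mem_univ,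
      true_and]
    constructor
    · rintro (hx | ⟨i, rfl⟩)
      · exact h hx
      · exact (Finset.mem_sdiff.1 (he i)).1
    · intro hx
      by_cases hxA : x ∈ A
      · exact Or.inl hxA
      · exact Or.inr (hes x (Finset.mem_sdiff.2 ⟨hx, hxA⟩))
  · intro y hAy hyB
    refine ⟨Finset.univ.filter fun i => e i ∈ y, ?_⟩
    ext x
    simp only [OrderEmbedding.coe_ofMapLEIff, Finset.mem_union, Finset.mem_map, Finset.mem_filter,
      Finset.mem_univ, true_and]
    constructor
    · rintro (hx | ⟨i, hi, rfl⟩)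
      · exact hAy hx
      · exact hi
    · intro hx
      by_cases hxA : x ∈ A
      · exact Or.inl hxA
      · obtain ⟨i, rfl⟩ := hes x (Finset.mem_sdiff.2 ⟨hyB hx, hxA⟩)
        exact Or.inr ⟨i, hx, rfl⟩

/-- The chains of subsets of an `n`-element set that contain `∅` and the whole set. -/
abbrev SubsetChain (n : ℕ) : Type := IntervalChain (∅ : Finset (Fin n)) Finset.univ

/-- The chains of subsets of an `n`-element set that contain the whole set, together with a
subset contained in all the members. -/
abbrev PointedSubsetChain (n : ℕ) : Type := PointedChain (∅ : Finset (Fin n)) Finset.univ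

section

variable {ι : Type} [DecidableEq ι] {A B : Finset ι}

theorem nonempty_orderIso_subsetChain (h : A ⊆ B) :
    Nonempty (SubsetChain (B.card - A.card) ≃o IntervalChain A B) := by
  obtain ⟨g, hA, hB, hg⟩ := exists_orderEmbedding_interval h
  obtain ⟨e, -⟩ := IntervalChain.exists_mapIso g ∅ Finset.univ (by rw [hA, hB]; exact hg)
  rw [hA, hB] at e
  exact ⟨e⟩

theorem nonempty_orderIso_pointedSubsetChain (h : A ⊆ B) :
    Nonempty (PointedSubsetChain (B.card - A.card) ≃o PointedChain A B) := by
  obtain ⟨g, hA, hB, hg⟩ := exists_orderEmbedding_interval h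
  have := PointedChain.nonempty_mapIso g ∅ Finset.univ (by rw [hA, hB]; exact hg)
  rwa [hA, hB] at this

theorem chainSum_eq [Finite ι] (h : A ⊆ B) :
    chainSum A B = chainSum (∅ : Finset (Fin (B.card - A.card))) Finset.univ := by
  obtain ⟨g, hA, hB, hg⟩ := exists_orderEmbedding_interval h
  have := chainSum_map g ∅ Finset.univ (by rw [hA, hB]; exact hg)
  rw [hA, hB] at this
  exact this.symm

end

theorem subsetChain_subsingleton : Subsingleton (SubsetChain 0) := by
  refine ⟨fun C D => Subtype.ext ?_⟩
  have h : ∀ E : SubsetChain 0, E.1 = {∅} := fun E =>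
    Finset.eq_singleton_iff_unique_mem.2 ⟨E.2.1, fun x _ => Subsingleton.elim _ _⟩
  rw [h, h]

noncomputable instance : Unique (SubsetChain 0) :=
  haveI := subsetChain_subsingleton
  uniqueOfSubsingleton ⟨{∅}, by simp, by simp [Finset.univ_eq_empty], by simp, by simp⟩

end FinsetChains

/-! ### Permutohedra and chains of subsets. -/

section CompleteGraph

theorem connected_induce_top_iff {V : Type*} {S : Finset V} :
    ((⊤ : SimpleGraph V).induce (S : Set V)).Connected ↔ S.Nonempty := by
  rw [SimpleGraph.induce_top]
  constructor
  · intro h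
    obtain ⟨⟨v, hv⟩⟩ := h.nonempty
    exact ⟨v, hv⟩
  · rintro ⟨v, hv⟩
    have : Nonempty (S : Set V) := ⟨⟨v, hv⟩⟩
    exact SimpleGraph.connected_top

variable {n : ℕ} [NeZero n]

/-- The nested sets of a complete graph are chains. -/
theorem exists_nestedSets_top_orderIso :
    ∃ e : nestedSets (⊤ : SimpleGraph (Fin n)) ≃o SubsetChain n,
      ∀ N, (e N).1.card = N.1.card + 2 := by
  -- Since `n` is nonzero, the two adjoined ends are distinct, so the cardinality shifts by exactly
  -- two.
  have hne : (∅ : Finset (Fin n)) ≠ Finset.univ := Finset.univ_nonempty.ne_empty.symm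
  have hnot : ∀ N : nestedSets (⊤ : SimpleGraph (Fin n)), ∅ ∉ N.1 := fun N h => by
    have := connected_induce_top_iff.1 (N.2.1.1 ∅ h)
    simp at this
  have hchain : ∀ N : nestedSets (⊤ : SimpleGraph (Fin n)), ∀ S ∈ N.1, ∀ T ∈ N.1,
      S ≤ T ∨ T ≤ S := by
    intro N S hS T hT
    rcases N.2.1.2 S hS T hT with h | h | h
    · exact Or.inl h
    · exact Or.inr h
    · rw [← Finset.coe_union] at h
      refine absurd (connected_induce_top_iff.2 ?_) h
      exact (connected_induce_top_iff.1 (N.2.1.1 S hS)).mono Finset.subset_union_left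
  let f : nestedSets (⊤ : SimpleGraph (Fin n)) ↪o SubsetChain n :=
    OrderEmbedding.ofMapLEIff
      (fun N => ⟨insert ∅ (insert Finset.univ N.1), by simp, by simp, by
        intro S hS T hT _
        simp only [Finset.coe_insert, Set.mem_insert_iff, Finset.mem_coe] at hS hT
        rcases hS with rfl | rfl | hS
        · exact Or.inl (Finset.empty_subset _)
        · exact Or.inr (Finset.subset_univ _)
        · rcases hT with rfl | rfl | hT
          · exact Or.inr (Finset.empty_subset _)
          · exact Or.inl (Finset.subset_univ _)
          · exact hchain N S hS T hT,
        fun S _ => ⟨Finset.empty_subset _, Finset.subset_univ _⟩⟩)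
      (by
        intro N M
        change insert ∅ (insert Finset.univ N.1) ⊆ insert ∅ (insert Finset.univ M.1) ↔ N.1 ⊆ M.1
        constructor
        · intro h S hS
          have := h (Finset.mem_insert_of_mem (Finset.mem_insert_of_mem hS))
          rcases Finset.mem_insert.1 this with rfl | this
          · exact absurd hS (hnot N)
          · rcases Finset.mem_insert.1 this with rfl | this
            · exact absurd hS N.2.2
            · exact this
        · exact fun h => Finset.insert_subset_insert _ (Finset.insert_subset_insert _ h))
  refine ⟨RelIso.ofSurjective f ?_, fun N => ?_⟩
  · intro C
    have hmem : ∀ S ∈ (C.1.erase ∅).erase Finset.univ, S ∈ C.1 := fun S hS =>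
      Finset.mem_of_mem_erase (Finset.mem_of_mem_erase hS)
    refine ⟨⟨(C.1.erase ∅).erase Finset.univ, ⟨fun S hS => ?_, fun S hS T hT => ?_⟩, by simp⟩, ?_⟩
    · rw [connected_induce_top_iff, Finset.nonempty_iff_ne_empty]
      exact (Finset.mem_erase.1 (Finset.mem_of_mem_erase hS)).1
    · exact (C.2.2.2.1.total (hmem S hS) (hmem T hT)).imp_right Or.inl
    · apply Subtype.ext
      change insert ∅ (insert Finset.univ ((C.1.erase ∅).erase Finset.univ)) = C.1
      rw [Finset.insert_erase (Finset.mem_erase.2 ⟨hne.symm, C.2.2.1⟩), Finset.insert_erase C.2.1]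
  · change (insert ∅ (insert Finset.univ N.1)).card = _
    rw [Finset.card_insert_of_notMem (by simp [hnot, hne]), Finset.card_insert_of_notMem N.2.2]

theorem exists_face_permutohedron_orderIso :
    ∃ e : Face (permutohedron n).carrier ≃o (SubsetChain n)ᵒᵈ, ∀ A,
      dim (permutohedron n).carrier - dim A.1 = (OrderDual.ofDual (e A)).1.card - 2 := by
  obtain ⟨e, he⟩ := exists_face_orderIso_nestedSets
    (SimpleGraph.connected_top (V := Fin n))
  obtain ⟨f, hf⟩ := exists_nestedSets_top_orderIso (n := n)
  refine ⟨e.trans f.dual, fun A => ?_⟩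
  change _ = (f (OrderDual.ofDual (e A))).1.card - 2
  rw [hf]
  exact he A

end CompleteGraph

/-! ### Stellohedra and pointed chains of leaf sets. -/

section StarGraph

variable {n : ℕ}

/-- Every edge of the star contains the centre, so a connected set with two vertices must contain
it. -/
theorem connected_induce_starGraph_iff {V : Type*} {c : V} {S : Finset V} :
    ((SimpleGraph.starGraph c).induce (S : Set V)).Connected ↔ c ∈ S ∨ ∃ v, S = {v} := by
  constructor
  · intro h
    by_contra! hcon
    obtain ⟨hc, hS⟩ := hcon
    obtain ⟨⟨v, hv⟩⟩ := h.nonempty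
    have : ∃ w ∈ S, w ∉ ({v} : Finset V) := by
      by_contra! hw
      exact hS v (Finset.eq_singleton_iff_unique_mem.2 ⟨hv, fun w h => Finset.mem_singleton.1
        (hw w h)⟩)
    obtain ⟨w, hw, hwv⟩ := this
    obtain ⟨a, ha, b, hb, -, -, hab⟩ :=
      exists_adj_of_connected h hv hw (Finset.mem_singleton_self v) hwv
    rcases (SimpleGraph.starGraph_adj.1 hab).2 with rfl | rfl
    · exact hc ha
    · exact hc hb
  · rintro (hc | ⟨v, rfl⟩)
    · rw [SimpleGraph.connected_iff_exists_forall_reachable]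
      refine ⟨⟨c, hc⟩, fun ⟨w, hw⟩ => ?_⟩
      by_cases h : c = w
      · subst h
        exact SimpleGraph.Reachable.refl _
      · exact SimpleGraph.Adj.reachable (by simp [h])
    · rw [Finset.coe_singleton]
      exact SimpleGraph.Connected.of_subsingleton

/-- The set of the centre of the star and the leaves in `A`. -/
def cone (A : Finset (Fin n)) : Finset (Fin (n + 1)) :=
  insert 0 (A.map (Fin.succEmb n))

theorem zero_mem_cone (A : Finset (Fin n)) : 0 ∈ cone A := Finset.mem_insert_self _ _

theorem succ_mem_cone {A : Finset (Fin n)} {i : Fin n} : i.succ ∈ cone A ↔ i ∈ A := by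
  simp [cone, Fin.succ_ne_zero]

theorem cone_subset_cone {A B : Finset (Fin n)} : cone A ⊆ cone B ↔ A ⊆ B := by
  constructor
  · exact fun h i hi => succ_mem_cone.1 (h (succ_mem_cone.2 hi))
  · exact fun h => Finset.insert_subset_insert _ (Finset.map_subset_map.2 h)

theorem cone_injective : Function.Injective (cone (n := n)) := fun _ _ h =>
  (cone_subset_cone.1 h.subset).antisymm (cone_subset_cone.1 h.superset)

theorem exists_cone_eq {S : Finset (Fin (n + 1))} (h : 0 ∈ S) : ∃ A, cone A = S := by
  refine ⟨Finset.univ.filter fun i => i.succ ∈ S, ?_⟩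
  ext i
  refine Fin.cases ?_ (fun i => ?_) i
  · simp [zero_mem_cone, h]
  · simp [succ_mem_cone]

theorem cone_univ : cone (Finset.univ : Finset (Fin n)) = Finset.univ := by
  ext i
  refine Fin.cases ?_ (fun i => ?_) i
  · simp [zero_mem_cone]
  · simp [succ_mem_cone]

theorem cone_ne_singleton_succ (A : Finset (Fin n)) (i : Fin n) :
    cone A ≠ {i.succ} := fun h => by
  have := zero_mem_cone A
  rw [h, Finset.mem_singleton] at this
  exact Fin.succ_ne_zero i this.symm

/-- The tubes of the star given by a set of leaves and a set of proper subsets of the leaves. -/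
def starTubes (p : Finset (Fin n) × Finset (Finset (Fin n))) : Finset (Finset (Fin (n + 1))) :=
  -- The cone over all leaves is the whole vertex set, which is not a proper tube.
  p.1.image (fun i => {i.succ}) ∪ (p.2.erase Finset.univ).image cone

theorem mem_starTubes {p : Finset (Fin n) × Finset (Finset (Fin n))} {S : Finset (Fin (n + 1))} :
    S ∈ starTubes p ↔ (∃ i ∈ p.1, {i.succ} = S) ∨ ∃ A ∈ p.2.erase Finset.univ, cone A = S := by
  simp only [starTubes, Finset.mem_union, Finset.mem_image]

theorem singleton_mem_starTubes {p : Finset (Fin n) × Finset (Finset (Fin n))} {i : Fin n} :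
    {i.succ} ∈ starTubes p ↔ i ∈ p.1 := by
  rw [mem_starTubes]
  constructor
  · rintro (⟨j, hj, h⟩ | ⟨A, -, h⟩)
    · rwa [← Fin.succ_injective _ (Finset.singleton_injective h)]
    · exact absurd h (cone_ne_singleton_succ A i)
  · exact fun h => Or.inl ⟨i, h, rfl⟩

theorem cone_mem_starTubes {p : Finset (Fin n) × Finset (Finset (Fin n))} {A : Finset (Fin n)} :
    cone A ∈ starTubes p ↔ A ∈ p.2.erase Finset.univ := by
  rw [mem_starTubes]
  constructor
  · rintro (⟨j, hj, h⟩ | ⟨B, hB, h⟩)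
    · exact absurd h.symm (cone_ne_singleton_succ A j)
    · rwa [← cone_injective h]
  · exact fun h => Or.inr ⟨A, h, rfl⟩

theorem card_starTubes (p : Finset (Fin n) × Finset (Finset (Fin n))) :
    (starTubes p).card = p.1.card + (p.2.erase Finset.univ).card := by
  rw [starTubes, Finset.card_union_of_disjoint, Finset.card_image_of_injective _ cone_injective,
    Finset.card_image_of_injective]
  · exact fun i j h => Fin.succ_injective _ (Finset.singleton_injective h)
  · rw [Finset.disjoint_left]
    rintro _ h h'
    obtain ⟨i, -, rfl⟩ := Finset.mem_image.1 h
    obtain ⟨A, -, h⟩ := Finset.mem_image.1 h'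
    exact cone_ne_singleton_succ A i h

/-- Two leaf singletons are always compatible, their union being disconnected if they differ. A leaf
singleton is contained in each cone because `L` lies below every member of the chain. -/
theorem starTubes_mem_nestedSets (p : PointedSubsetChain n) :
    starTubes p.1 ∈ nestedSets (SimpleGraph.starGraph (0 : Fin (n + 1))) := by
  obtain ⟨⟨L, C⟩, -, -, hch, hC⟩ := p
  refine ⟨⟨fun S hS => ?_, fun S hS T hT => ?_⟩, fun h => ?_⟩
  · rw [connected_induce_starGraph_iff]
    rcases mem_starTubes.1 hS with ⟨i, -, rfl⟩ | ⟨A, -, rfl⟩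
    · exact Or.inr ⟨_, rfl⟩
    · exact Or.inl (zero_mem_cone A)
  · rcases mem_starTubes.1 hS with ⟨i, hi, rfl⟩ | ⟨A, hA, rfl⟩ <;>
      rcases mem_starTubes.1 hT with ⟨j, hj, rfl⟩ | ⟨B, hB, rfl⟩
    · by_cases hij : i = j
      · exact Or.inl (by rw [hij])
      · refine Or.inr (Or.inr fun h => ?_)
        rw [← Finset.coe_union] at h
        rcases connected_induce_starGraph_iff.1 h with h | ⟨v, h⟩
        · simp [Fin.succ_ne_zero, eq_comm (a := (0 : Fin (n + 1)))] at h
        · have h1 : i.succ = v := Finset.mem_singleton.1 (h ▸ by simp)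
          have h2 : j.succ = v := Finset.mem_singleton.1 (h ▸ by simp)
          exact hij (Fin.succ_injective _ (h1.trans h2.symm))
    · refine Or.inl (Finset.singleton_subset_iff.2 (succ_mem_cone.2 ?_))
      exact (hC B (Finset.mem_of_mem_erase hB)).1 hi
    · refine Or.inr (Or.inl (Finset.singleton_subset_iff.2 (succ_mem_cone.2 ?_)))
      exact (hC A (Finset.mem_of_mem_erase hA)).1 hj
    · rw [cone_subset_cone, cone_subset_cone]
      exact (hch.total (Finset.mem_of_mem_erase hA) (Finset.mem_of_mem_erase hB)).imp_right Or.inl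
  · rw [← cone_univ, cone_mem_starTubes] at h
    simp at h

/-- The union of a cone with any other tube contains the centre and is connected, so compatibility
forces comparability: cones form a chain, and a leaf whose singleton occurs lies in every cone. -/
theorem exists_starTubes_eq
    (N : nestedSets (SimpleGraph.starGraph (0 : Fin (n + 1)))) :
    ∃ p : PointedSubsetChain n, starTubes p.1 = N.1 := by
  have hL : ∀ i A, {i.succ} ∈ N.1 → cone A ∈ N.1 → i ∈ A := by
    intro i A hi hA
    rcases N.2.1.2 _ hi _ hA with h | h | h
    · exact succ_mem_cone.1 (Finset.singleton_subset_iff.1 h)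
    · have := h (zero_mem_cone A)
      exact absurd (Finset.mem_singleton.1 this).symm (Fin.succ_ne_zero i)
    · rw [← Finset.coe_union] at h
      refine absurd (connected_induce_starGraph_iff.2 (Or.inl ?_)) h
      exact Finset.mem_union_right _ (zero_mem_cone A)
  have hC : ∀ A B, cone A ∈ N.1 → cone B ∈ N.1 → A ⊆ B ∨ B ⊆ A := by
    intro A B hA hB
    rcases N.2.1.2 _ hA _ hB with h | h | h
    · exact Or.inl (cone_subset_cone.1 h)
    · exact Or.inr (cone_subset_cone.1 h)
    · rw [← Finset.coe_union] at h
      refine absurd (connected_induce_starGraph_iff.2 (Or.inl ?_)) h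
      exact Finset.mem_union_right _ (zero_mem_cone B)
  refine ⟨⟨(Finset.univ.filter fun i => {i.succ} ∈ N.1,
    insert Finset.univ (Finset.univ.filter fun A => cone A ∈ N.1)), Finset.empty_subset _,
    Finset.mem_insert_self _ _, ?_, ?_⟩, ?_⟩
  · intro A hA B hB _
    simp only [Finset.coe_insert, Set.mem_insert_iff, Finset.mem_coe, Finset.mem_filter,
      Finset.mem_univ, true_and] at hA hB
    rcases hA with rfl | hA
    · exact Or.inr (Finset.subset_univ _)
    · rcases hB with rfl | hB
      · exact Or.inl (Finset.subset_univ _)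
      · exact hC A B hA hB
  · intro A hA
    refine ⟨?_, Finset.subset_univ _⟩
    rcases Finset.mem_insert.1 hA with rfl | hA
    · exact Finset.subset_univ _
    · exact fun i hi => hL i A (Finset.mem_filter.1 hi).2 (Finset.mem_filter.1 hA).2
  · ext S
    constructor
    · intro hS
      rcases mem_starTubes.1 hS with ⟨i, hi, rfl⟩ | ⟨A, hA, rfl⟩
      · exact (Finset.mem_filter.1 hi).2
      · rw [Finset.mem_erase, Finset.mem_insert] at hA
        exact (Finset.mem_filter.1 (hA.2.resolve_left hA.1)).2
    · intro hS
      have hzero : 0 ∈ S → S ∈ starTubes (Finset.univ.filter fun i => {i.succ} ∈ N.1,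
          insert Finset.univ (Finset.univ.filter fun A => cone A ∈ N.1)) := by
        intro h
        obtain ⟨A, rfl⟩ := exists_cone_eq h
        rw [cone_mem_starTubes, Finset.mem_erase, Finset.mem_insert]
        refine ⟨?_, Or.inr (Finset.mem_filter.2 ⟨Finset.mem_univ _, hS⟩)⟩
        rintro rfl
        rw [cone_univ] at hS
        exact N.2.2 hS
      rcases connected_induce_starGraph_iff.1 (N.2.1.1 S hS) with h | ⟨v, rfl⟩
      · exact hzero h
      · obtain rfl | ⟨i, rfl⟩ := Fin.eq_zero_or_eq_succ v
        -- The singleton of the centre is the cone over `∅`, so it belongs to the chain and not to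
        -- `L`.
        · exact hzero (Finset.mem_singleton_self _)
        · exact singleton_mem_starTubes.2 (Finset.mem_filter.2 ⟨Finset.mem_univ _, hS⟩)

/-- The nested sets of a star are pointed chains of sets of leaves. -/
theorem exists_nestedSets_starGraph_orderIso :
    ∃ e : nestedSets (SimpleGraph.starGraph (0 : Fin (n + 1))) ≃o PointedSubsetChain n,
      ∀ N, (e N).1.1.card + (e N).1.2.card = N.1.card + 1 := by
  let f : PointedSubsetChain n ↪o nestedSets (SimpleGraph.starGraph (0 : Fin (n + 1))) :=
    OrderEmbedding.ofMapLEIff (fun p => ⟨starTubes p.1, starTubes_mem_nestedSets p⟩) (by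
      intro p q
      change starTubes p.1 ⊆ starTubes q.1 ↔ p.1.1 ⊆ q.1.1 ∧ p.1.2 ⊆ q.1.2
      constructor
      · refine fun h => ⟨fun i hi => singleton_mem_starTubes.1 (h (singleton_mem_starTubes.2 hi)),
          fun A hA => ?_⟩
        by_cases hAu : A = Finset.univ
        · rw [hAu]
          exact q.2.2.1
        · exact Finset.mem_of_mem_erase
            (cone_mem_starTubes.1 (h (cone_mem_starTubes.2 (Finset.mem_erase.2 ⟨hAu, hA⟩))))
      · rintro ⟨h1, h2⟩
        exact Finset.union_subset_union (Finset.image_subset_image h1)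
          (Finset.image_subset_image (Finset.erase_subset_erase _ h2)))
  have hf : Function.Surjective f := fun N => by
    obtain ⟨p, hp⟩ := exists_starTubes_eq N
    exact ⟨p, Subtype.ext hp⟩
  let e := RelIso.ofSurjective f hf
  refine ⟨OrderIso.symm e, fun N => ?_⟩
  obtain ⟨p, rfl⟩ := e.surjective N
  rw [show OrderIso.symm e (e p) = p from e.symm_apply_apply p]
  change _ = (starTubes p.1).card + 1
  rw [card_starTubes, add_assoc, Finset.card_erase_add_one p.2.2.1]

theorem exists_face_stellohedron_orderIso (n : ℕ) :
    ∃ e : Face (stellohedron (n + 1)).carrier ≃o (PointedSubsetChain n)ᵒᵈ, ∀ A,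
      dim (stellohedron (n + 1)).carrier - dim A.1 =
        (OrderDual.ofDual (e A)).1.1.card + (OrderDual.ofDual (e A)).1.2.card - 1 := by
  obtain ⟨e, he⟩ := exists_face_orderIso_nestedSets
    (SimpleGraph.connected_starGraph (0 : Fin (n + 1)))
  obtain ⟨f, hf⟩ := exists_nestedSets_starGraph_orderIso (n := n)
  refine ⟨e.trans f.dual, fun A => ?_⟩
  change _ = (f (OrderDual.ofDual (e A))).1.1.card + (f (OrderDual.ofDual (e A))).1.2.card - 1
  rw [hf]
  exact he A

end StarGraph

end PolytopeRing

namespace PolytopeRing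

/-! ### Recursions for the classes and the motivic interiors. -/

section Recursions

theorem permutohedron_toRing (n : ℕ) [NeZero n] :
    (permutohedron n).toRing = posetClass (SubsetChain n) := by
  obtain ⟨e, -⟩ := exists_face_permutohedron_orderIso (n := n)
  exact (permutohedron n).toRing_eq e

theorem stellohedron_toRing (n : ℕ) :
    (stellohedron (n + 1)).toRing = posetClass (PointedSubsetChain n) := by
  obtain ⟨e, -⟩ := exists_face_stellohedron_orderIso n
  exact (stellohedron (n + 1)).toRing_eq e

theorem isRealizable_subsetChain (n : ℕ) : IsRealizable (SubsetChain n) := by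
  cases n with
  | zero => exact ⟨1, isRealizedBy_one⟩
  | succ n =>
    obtain ⟨e, -⟩ := exists_face_permutohedron_orderIso (n := n + 1)
    exact ⟨_, (permutohedron (n + 1)).isRealizedBy e⟩

theorem isRealizable_pointedSubsetChain (n : ℕ) : IsRealizable (PointedSubsetChain n) := by
  obtain ⟨e, -⟩ := exists_face_stellohedron_orderIso n
  exact ⟨_, (stellohedron (n + 1)).isRealizedBy e⟩

section

variable {ι : Type} [DecidableEq ι]

theorem isRealizable_intervalChain (A B : Finset ι) (h : A ≤ B) :
    IsRealizable (IntervalChain A B) := by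
  obtain ⟨e⟩ := nonempty_orderIso_subsetChain h
  exact (isRealizable_subsetChain _).congr e

theorem isRealizable_pointedChain (A B : Finset ι) (h : A ≤ B) :
    IsRealizable (PointedChain A B) := by
  obtain ⟨e⟩ := nonempty_orderIso_pointedSubsetChain h
  exact (isRealizable_pointedSubsetChain _).congr e

theorem posetClass_intervalChain {A B : Finset ι} (h : A ⊆ B) :
    posetClass (IntervalChain A B) = posetClass (SubsetChain (B.card - A.card)) := by
  obtain ⟨e⟩ := nonempty_orderIso_subsetChain h
  exact (posetClass_congr e).symm

theorem posetClass_pointedChain {A B : Finset ι} (h : A ⊆ B) :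
    posetClass (PointedChain A B) = posetClass (PointedSubsetChain (B.card - A.card)) := by
  obtain ⟨e⟩ := nonempty_orderIso_pointedSubsetChain h
  exact (posetClass_congr e).symm

end

/-- The signed sum of the classes of the faces of a permutohedron, the coefficient of its weighted
motivic interior in `Π°`. -/
noncomputable def subsetChainSum (n : ℕ) : PRing :=
  chainSum (∅ : Finset (Fin n)) Finset.univ

theorem chainSum_finset {ι : Type} [DecidableEq ι] [Finite ι] {A B : Finset ι} (h : A ⊆ B) :
    chainSum A B = subsetChainSum (B.card - A.card) :=
  chainSum_eq h

theorem posetClass_subsetChain_zero : posetClass (SubsetChain 0) = 1 := posetClass_unique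

theorem subsetChainSum_zero : subsetChainSum 0 = 1 := by
  rw [subsetChainSum, chainSum, Fintype.sum_unique]
  have : Unique (Set.Ici (default : SubsetChain 0)) :=
    { default := ⟨default, Set.mem_Ici.2 le_rfl⟩
      uniq := fun x => Subsingleton.elim _ _ }
  rw [posetClass_unique]
  have hc : (default : SubsetChain 0).1.card = 1 := Finset.card_singleton _
  rw [hc]
  norm_num

/-- The single equation fixes the only coordinate, so the polytope is a point. This reduces the
weighted interior to evaluation at `-1`. -/
theorem permutohedron_one_toRing : (permutohedron 1).toRing = 1 := by
  have hsub : ∀ x ∈ (permutohedron 1).carrier, ∀ y ∈ (permutohedron 1).carrier, x = y := by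
    intro x hx y hy
    ext i
    have h1 := hx.1
    have h2 := hy.1
    rw [Fin.sum_univ_one] at h1 h2
    rw [Subsingleton.elim i 0, h1, h2]
  have hface : ∀ A : Face (permutohedron 1).carrier, A.1 = (permutohedron 1).carrier := by
    intro A
    obtain ⟨a, ha⟩ := A.2.1
    exact A.2.2.subset.antisymm fun x hx => hsub a (A.2.2.subset ha) x hx ▸ ha
  have : Unique (Face (permutohedron 1).carrier) :=
    { default := ⟨_, (permutohedron 1).isPolytope.1, IsExposed.refl _⟩
      uniq := fun A => Subtype.ext (hface A) }
  rw [Polytope.toRing, ← map_one (MonoidAlgebra.of ℤ CombPolytope)]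
  congr 1
  obtain ⟨e⟩ := Polytope.face_point
  exact Quotient.sound ⟨(OrderIso.ofUnique _ _).trans e.symm⟩

/-- The face of a chain `C` has codimension `C.card - 2`, of parity opposite to the exponent `C.card
+ 1` in `chainSum`. This accounts for the minus sign in `Π°`. -/
theorem permutohedronInterior_eq (n : ℕ) [NeZero n] :
    permutohedronInterior n = -subsetChainSum n := by
  obtain ⟨e, he⟩ := exists_face_permutohedron_orderIso (n := n)
  rw [permutohedronInterior, permutohedron_one_toRing,
    (permutohedron n).eval_facePolynomial e (fun C => C.1.card - 2) he, subsetChainSum, chainSum,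
    ← Finset.sum_neg_distrib]
  refine Finset.sum_congr rfl fun C _ => ?_
  have hc : 2 ≤ C.1.card := by
    rw [← Finset.card_pair (Finset.univ_nonempty (α := Fin n)).ne_empty.symm]
    exact Finset.card_le_card (Finset.insert_subset C.2.1
      (Finset.singleton_subset_iff.2 C.2.2.1))
  obtain ⟨k, hk⟩ := Nat.exists_eq_add_of_le hc
  rw [hk, show 2 + k - 2 = k by omega, show 2 + k + 1 = k + 2 + 1 by ring, pow_succ, pow_add]
  ring

/-- The codimension `|L| + |C| - 1` has the parity of `|L| + |C| + 1`, so this is `sum_pointedChain`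
for the Boolean lattice with weight `|L|`. -/
theorem stellohedronInterior_eq (n : ℕ) :
    (stellohedron (n + 1)).interior =
      ∑ A : Finset (Fin n), (∑ L ∈ A.powerset,
        (-1) ^ L.card * posetClass (PointedSubsetChain (A.card - L.card))) *
          subsetChainSum (n - A.card) := by
  obtain ⟨e, he⟩ := exists_face_stellohedron_orderIso n
  rw [Polytope.interior, (stellohedron (n + 1)).eval_facePolynomial e
    (fun p => p.1.1.card + p.1.2.card - 1) he]
  have h := sum_pointedChain (∅ : Finset (Fin n)) Finset.univ Finset.card
    isRealizable_intervalChain isRealizable_pointedChain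
  refine Eq.trans (Finset.sum_congr rfl fun p _ => ?_) (h.trans ?_)
  · have hc : 1 ≤ p.1.2.card := Finset.card_pos.2 ⟨_, p.2.2.1⟩
    obtain ⟨k, hk⟩ := Nat.exists_eq_add_of_le hc
    rw [hk, show p.1.1.card + (1 + k) - 1 = p.1.1.card + k by omega,
      show p.1.1.card + (1 + k) + 1 = p.1.1.card + k + 2 by ring, pow_add _ (_ + k)]
    ring
  · refine Finset.sum_congr (by ext; simp) fun A _ => ?_
    rw [chainSum_finset (Finset.subset_univ A), Finset.card_univ, Fintype.card_fin]
    congr 1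
    refine Finset.sum_congr (by ext; simp) fun L hL => ?_
    rw [posetClass_pointedChain (Finset.mem_powerset.1 hL)]

/-- This is `Π Π° = 1` in coefficients. For `n > 0` the term `A = ∅` is `subsetChainSum n`, and
`chainSum_eq_neg_sum` says that the other terms cancel it. -/
theorem sum_posetClass_mul_subsetChainSum (n : ℕ) :
    ∑ A : Finset (Fin n), posetClass (SubsetChain A.card) * subsetChainSum (n - A.card) =
      if n = 0 then 1 else 0 := by
  by_cases hn : n = 0
  · subst hn
    rw [Fintype.sum_unique, if_pos rfl, Subsingleton.elim default (∅ : Finset (Fin 0)),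
      Finset.card_empty, posetClass_subsetChain_zero, subsetChainSum_zero, one_mul]
  · have : NeZero n := ⟨hn⟩
    rw [if_neg hn, Fintype.sum_eq_add_sum_compl ∅, Finset.card_empty, posetClass_subsetChain_zero,
      one_mul, Nat.sub_zero, add_eq_zero_iff_eq_neg]
    have hlt : (∅ : Finset (Fin n)) < Finset.univ :=
      Finset.empty_ssubset.2 Finset.univ_nonempty
    rw [subsetChainSum, chainSum_eq_neg_sum hlt isRealizable_intervalChain]
    congr 1
    refine Finset.sum_congr ?_ fun A _ => ?_
    · ext A
      simp [Finset.nonempty_iff_ne_empty]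
    · rw [chainSum_finset (Finset.subset_univ A), Finset.card_univ, Fintype.card_fin,
        posetClass_intervalChain (Finset.empty_subset A), Finset.card_empty, Nat.sub_zero]

end Recursions

/-! ### Exponential generating functions and the final identities. -/

section GeneratingFunctions

/-- Grouping the subsets by size produces the binomial coefficients of an exponential convolution.
-/
theorem egf_mul (a b : ℕ → PRing) :
    egf a * egf b = egf fun n => ∑ A : Finset (Fin n), a A.card * b (n - A.card) := by
  ext n : 1
  have hsum : ∑ A : Finset (Fin n), a A.card * b (n - A.card) =
      ∑ m ∈ Finset.range (n + 1), n.choose m • (a m * b (n - m)) := by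
    have := Finset.sum_powerset_apply_card (fun m => a m * b (n - m))
      (x := (Finset.univ : Finset (Fin n)))
    simpa using this
  rw [PowerSeries.coeff_mul, Finset.Nat.sum_antidiagonal_eq_sum_range_succ_mk]
  simp only [egf, PowerSeries.coeff_mk]
  rw [hsum, map_sum, Finset.smul_sum]
  refine Finset.sum_congr rfl fun m hm => ?_
  have hmn : m ≤ n := Nat.lt_succ_iff.1 (Finset.mem_range.1 hm)
  rw [map_nsmul, map_mul, smul_mul_smul_comm, ← Nat.cast_smul_eq_nsmul ℚ, smul_smul]
  congr 1
  rw [Nat.cast_choose ℚ hmn]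
  have h1 : (n.factorial : ℚ) ≠ 0 := by exact_mod_cast n.factorial_ne_zero
  have h2 : (m.factorial : ℚ) ≠ 0 := by exact_mod_cast m.factorial_ne_zero
  have h3 : ((n - m).factorial : ℚ) ≠ 0 := by exact_mod_cast (n - m).factorial_ne_zero
  field_simp

theorem egf_add (a b : ℕ → PRing) : egf a + egf b = egf fun n => a n + b n := by
  ext n : 1
  simp only [egf, map_add, PowerSeries.coeff_mk, smul_add]

theorem egf_neg (a : ℕ → PRing) : -egf a = egf fun n => -a n := by
  ext n : 1
  simp only [egf, map_neg, PowerSeries.coeff_mk, smul_neg]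

theorem egf_one : egf (fun n => if n = 0 then 1 else 0) = 1 := by
  ext n : 1
  rw [egf, PowerSeries.coeff_mk, PowerSeries.coeff_one]
  split_ifs with h
  · simp [h]
  · simp

theorem expNeg_eq : expNeg = egf fun n => (-1) ^ n := by
  ext n : 1
  rw [expNeg, egf, PowerSeries.coeff_rescale, PowerSeries.coeff_mk, PowerSeries.coeff_exp,
    map_pow, map_neg, map_one, mul_comm, Algebra.smul_def]

theorem permutohedronSeries_eq :
    permutohedronSeries = egf fun n => posetClass (SubsetChain n) := by
  rw [permutohedronSeries, Nat.cast_one, ← egf_one, egf_add]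
  congr 1
  ext n : 1
  cases n with
  | zero => simp [posetClass_subsetChain_zero]
  | succ n => simp [permutohedron_toRing]

theorem permutohedronInteriorSeries_eq : permutohedronInteriorSeries = egf subsetChainSum := by
  rw [permutohedronInteriorSeries, Nat.cast_one, ← egf_one, sub_eq_add_neg, egf_neg, egf_add]
  congr 1
  ext n : 1
  cases n with
  | zero => simp [subsetChainSum_zero]
  | succ n => simp [permutohedronInterior_eq]

theorem permutohedronSeries_mul_interior :
    permutohedronSeries * permutohedronInteriorSeries = 1 := by
  rw [permutohedronSeries_eq, permutohedronInteriorSeries_eq, egf_mul, ← egf_one]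
  congr 1
  ext n : 1
  exact sum_posetClass_mul_subsetChainSum n

theorem stellohedronInteriorSeries_eq :
    stellohedronInteriorSeries = expNeg * permutohedronInteriorSeries * stellohedronSeries := by
  rw [mul_right_comm, expNeg_eq, permutohedronInteriorSeries_eq, stellohedronSeries, egf_mul,
    egf_mul, stellohedronInteriorSeries]
  congr 1
  ext n : 1
  rw [stellohedronInterior_eq]
  refine Finset.sum_congr rfl fun A _ => ?_
  congr 1
  -- The sum over `L ⊆ A` depends only on `A.card`. Both it and the corresponding sum over `Finset
  -- (Fin A.card)` reduce to the same binomial sum, the coefficient of `e^{-x} S`.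
  have h1 := Finset.sum_powerset_apply_card
    (fun m => (-1) ^ m * posetClass (PointedSubsetChain (A.card - m))) (x := A)
  have h2 := Finset.sum_powerset_apply_card
    (fun m => (-1) ^ m * posetClass (PointedSubsetChain (A.card - m)))
    (x := (Finset.univ : Finset (Fin A.card)))
  simp only [Finset.card_univ, Fintype.card_fin, Finset.powerset_univ] at h2
  simp only [stellohedron_toRing]
  exact h1.trans h2.symm

end GeneratingFunctions

end PolytopeRing

theorem theorem7p1 :
    PolytopeRing.stellohedronInteriorSeries =
        PolytopeRing.expNeg * PolytopeRing.permutohedronInteriorSeries *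
          PolytopeRing.stellohedronSeries ∧
      IsUnit PolytopeRing.permutohedronSeries ∧
      PolytopeRing.stellohedronInteriorSeries =
        PolytopeRing.expNeg * Ring.inverse PolytopeRing.permutohedronSeries *
          PolytopeRing.stellohedronSeries := by
  have hinv := PolytopeRing.permutohedronSeries_mul_interior
  refine ⟨PolytopeRing.stellohedronInteriorSeries_eq, IsUnit.of_mul_eq_one _ hinv, ?_⟩
  -- Writing `1` as `Π Π°` and cancelling turns the inverse of `Π` into `Π°`.
  rw [← mul_one (Ring.inverse PolytopeRing.permutohedronSeries), ← hinv,
    Ring.inverse_mul_cancel_left _ _ (IsUnit.of_mul_eq_one _ hinv)]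
  exact PolytopeRing.stellohedronInteriorSeries_eq
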